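/- **Setting.** Let $D\ge 1$, let $\Omega\subset\mathbb R^D$ be a bounded domain with $C^\infty$ boundary, with outward unit normal $\mathrm n(x)$ and surface measure $d\sigma_x$ on $\partial\Omega$. Let $M(v)=(2\pi)^{-D/2}e^{-|v|^2/2}$ and $\langle\xi\rangle=\int_{\mathbb R^D}\xi(v)M(v)\,dv$. *Collision kernel.* Let $b(\omega,v_1-v)=|v_1-v|\,\Sigma(|\omega\cdot \tfrac{v_1-v}{|v_1-v|}|,|v_1-v|)$ be measurable and positive almost everywhere, and put $\bar b(z)=\int_{\mathbb S^{D-1}}b(\omega,z)\,d\omega$, $a(v)=\int\bar b(v_1-v)M(v_1)\,dv_1$, $d\mu=b(\omega,v_1-v)\,d\omega\,M(v_1)dv_1\,M(v)dv$. Assume that $\mu$ has total mass $1$ and that: (1) $b$ is locally integrable with respect to $d\omega\,M_1dv_1\,Mdv$ and $\frac1{1+|v|^2}\int_K\bar b(v_1-v)\,dv_1\to0$ as $|v|\to\infty$ for every compact $K$; (2) $C_a(1+|v|^2)^{\beta_a}\le a(v)$ for some $C_a>0$, $\beta_a\in\mathbb R$; (3) for some $s\in(1,\infty]$ and $C_b<\infty$,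 $\big\|\frac{\bar b(\cdot-v)}{a(\cdot)a(v)}\big\|_{L^s(aM\,dv_1)}\le C_b$ for every $v$; (4) the operator $\mathcal K^+g=\frac1{2a}\iint(g'+g_1')\,b\,d\omega\,M_1dv_1$ is compact on $L^2(aM\,dv)$; (5) for every $\delta>0$ there is $C_\delta$ with $\bar b(v_1-v)\big/\big(1+\delta\frac{\bar b(v_1-v)}{1+|v_1-v|^2}\big)\le C_\delta(1+a(v_1))(1+a(v))$ for all $v,v_1$. Here primes denote evaluation at $v'=v+\omega\,\omega\cdot(v_1-v)$ and $v_1'=v_1-\omega\,\omega\cdot(v_1-v)$. *Solutions.* Let $\mathcal Q(G,G)=\iint(G_1'G'-G_1G)\,b\,d\omega\,M_1dv_1$, $\eta(z)=z\log z-z+1$, $H(G)=\int_\Omega\langle\eta(G)\rangle\,dx$, $R(G)=\frac14\int_\Omega\int\log\!\big(\tfrac{G_1'G'}{G_1G}\big)(G_1'G'-G_1G)\,d\mu\,dx$, $\langle\phi\rangle_{\partial\Omega}(x)=\sqrt{2\pi}\int_{v\cdot \mathrm n(x)>0}\phi(v,x)\,v\cdot \mathrm n(x)\,M\,dv$ and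 $\mathcal E(\gamma_+G)=\int_{\partial\Omega}\big[\langle\eta(\gamma_+G)\rangle_{\partial\Omega}-\eta(\langle\gamma_+G\rangle_{\partial\Omega})\big]d\sigma_x$. Fix $\alpha\in[0,1]$. For $\epsilon>0$ and measurable initial data $G^{\rm in}\ge0$ with $H(G^{\rm in})<\infty$, a DiPerna–Lions–Mischler renormalized solution is a measurable $G\ge0$ in $C([0,\infty);\text{w-}L^1(M\,dv\,dx))$ with $G(0)=G^{\rm in}$, for which the integral defining $\mathcal Q(G,G)$ converges absolutely almost everywhere, together with a measurable, finite, nonnegative trace $\gamma G$ on $\mathbb R^D\times\partial\Omega\times\mathbb R_+$, such that: - for every $t>0$, $H(G(t))+\int_0^t\big[\frac1\epsilon R(G(s))+\frac{\alpha}{\sqrt{2\pi}}\mathcal E(\gamma_+G(s))\big]ds\le H(G^{\rm in})$; - for every $\Gamma\in C^1([0,\infty))$ with $|\Gamma'(Z)|\le C_\Gamma/\sqrt{1+Z}$, every $0\le t_1\le t_2<\infty$ and every bounded $Y\in C^1(\mathbb R^D\times\overline\Omega)$ for which $\Gamma(G)\,v\cdot\nabla_xY$ is integrable on $(t_1,t_2)\times\mathbb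 R^D\times\Omega$ with respect to $M\,dv\,dx\,dt$, the other terms below are integrable and $$\int_\Omega\langle\Gamma(G(t_2))Y\rangle dx-\int_\Omega\langle\Gamma(G(t_1))Y\rangle dx+\int_{t_1}^{t_2}\!\!\int_{\partial\Omega}\langle\Gamma(\gamma G)\,Y\,(v\cdot \mathrm n)\rangle d\sigma_xdt-\int_{t_1}^{t_2}\!\!\int_\Omega\langle\Gamma(G)\,v\cdot\nabla_xY\rangle dxdt=\frac1\epsilon\int_{t_1}^{t_2}\!\!\int_\Omega\langle\Gamma'(G)\mathcal Q(G,G)Y\rangle dxdt;$$ - for almost every $(v,x,t)$ with $x\in\partial\Omega$ and $v\cdot \mathrm n(x)<0$, $\gamma G(v,x,t)=(1-\alpha)\,\gamma G(v-2(v\cdot \mathrm n)\mathrm n,x,t)+\alpha\langle\gamma_+G\rangle_{\partial\Omega}(x,t)$. **Proposition 5.1.** Let $\delta_\epsilon>0$ with $\delta_\epsilon\to0$ as $\epsilon\to0$. For every $\epsilon>0$ let $G_\epsilon^{\rm in}\ge0$ be measurable initial data with $H(G_\epsilon^{\rm in})<\infty$ and $H(G^{\rm in}_\epsilon)\le C^{\rm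 in}\delta_\epsilon^2$, where $C^{\rm in}<\infty$ does not depend on $\epsilon$, and let $G_\epsilon$ be a DiPerna–Lions–Mischler renormalized solution with initial data $G_\epsilon^{\rm in}$ and trace $\gamma G_\epsilon$. Put $\gamma\tilde g_\epsilon=\frac1{\delta_\epsilon}\,\frac{\gamma G_\epsilon-1}{1+(\gamma G_\epsilon-1)^2}$. Then for every $[t_1,t_2]\subset[0,\infty)$ and every $\chi\in C^1(\overline\Omega)$, the function $\chi\,\gamma\tilde g_\epsilon\,v\cdot \mathrm n$ is integrable with respect to $M\,dv\,d\sigma_x\,dt$ on $\mathbb R^D\times\partial\Omega\times[t_1,t_2]$ for each $\epsilon>0$, and $$\lim_{\epsilon\to0}\int_{t_1}^{t_2}\!\!\int_{\partial\Omega}\chi\,\langle v\,\gamma\tilde g_\epsilon\rangle\cdot \mathrm n\,d\sigma_x\,dt=0.$$ -/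

import Mathlib

open MeasureTheory Set Filter Topology
open scoped ENNReal ContDiff

namespace AcousticLimit

noncomputable section

/-- The Euclidean space of dimension `D`, used for velocities and for positions. -/
abbrev Space (D : ℕ) : Type := EuclideanSpace ℝ (Fin D)

/-- The unit sphere of `Space D`. -/
abbrev Sph (D : ℕ) : Type := Metric.sphere (0 : Space D) 1

/-! ### The spatial domain -/

/-- `ρ` is a smooth defining function of `Ω` near the point `p`: on a neighbourhood of `p`
the set `Ω` is `{ρ < 0}`, and the gradient of `ρ` does not vanish at `p`. -/
def IsLocalDefiningFunction {D : ℕ} (Ω : Set (Space D)) (p : Space D) (ρ : Space D → ℝ) : Prop :=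
  gradient ρ p ≠ 0 ∧
    ∃ U : Set (Space D), IsOpen U ∧ p ∈ U ∧ ContDiffOn ℝ ∞ ρ U ∧ ∀ x ∈ U, (x ∈ Ω ↔ ρ x < 0)

/-- A bounded domain (open connected nonempty set) with smooth boundary. -/
structure IsSmoothBoundedDomain {D : ℕ} (Ω : Set (Space D)) : Prop where
  isOpen : IsOpen Ω
  isConnected : IsConnected Ω
  isBounded : Bornology.IsBounded Ω
  smooth_boundary : ∀ p ∈ frontier Ω, ∃ ρ : Space D → ℝ, IsLocalDefiningFunction Ω p ρ

open Classical in
/-- The outward unit normal: the normalized gradient of a local defining function of `Ω`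
(it does not depend on the chosen defining function). -/
def outwardNormal {D : ℕ} (Ω : Set (Space D)) (x : Space D) : Space D :=
  if h : ∃ ρ : Space D → ℝ, IsLocalDefiningFunction Ω x ρ then
    ‖gradient h.choose x‖⁻¹ • gradient h.choose x
  else 0

/-- The surface (Lebesgue) measure `dσ` on the boundary of `Ω`: the `(D-1)`-dimensional Hausdorff
measure, normalized to agree with Lebesgue measure on hyperplanes. -/
def surfaceMeasure {D : ℕ} (Ω : Set (Space D)) : Measure (Space D) :=
  (Measure.euclideanHausdorffMeasure (D - 1)).restrict (frontier Ω)

/-! ### The global Maxwellian and the phase space -/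

/-- The global Maxwellian `M(v) = (2π)^{-D/2} exp(-|v|²/2)`. -/
def maxwellian {D : ℕ} (v : Space D) : ℝ :=
  (2 * Real.pi) ^ (-(D : ℝ) / 2) * Real.exp (-(‖v‖ ^ 2) / 2)

/-- The measure `M dv`. The average `⟨ξ⟩` is the integral of `ξ` against it. -/
def maxw (D : ℕ) : Measure (Space D) :=
  volume.withDensity fun v => ENNReal.ofReal (maxwellian v)

/-- The measure `M dv dx` on the phase space, whose points are the pairs `(v, x)`. -/
def phase {D : ℕ} (Ω : Set (Space D)) : Measure (Space D × Space D) :=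
  (maxw D).prod (volume.restrict Ω)

/-- The measure `M dv dσ dt` on `I × ∂Ω × ℝ^D`, points being written `(t, x, v)`. Since `n ≠ 0`
on `∂Ω`, it has the same null sets as `|v·n| M dv dσ dt`. -/
def boundaryTime {D : ℕ} (Ω : Set (Space D)) (I : Set ℝ) : Measure (ℝ × Space D × Space D) :=
  (volume.restrict I).prod ((surfaceMeasure Ω).prod (maxw D))

/-! ### Collisions -/

/-- The Lebesgue measure `dω` on the unit sphere. -/
def sphereMeasure (D : ℕ) : Measure (Sph D) := (volume : Measure (Space D)).toSphere

/-- The post-collisional velocity `v' = v + ω ω·(v₁ - v)`. -/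
def vPost {D : ℕ} (w : Sph D) (v₁ v : Space D) : Space D :=
  v + inner ℝ (w : Space D) (v₁ - v) • (w : Space D)

/-- The post-collisional velocity `v₁' = v₁ - ω ω·(v₁ - v)`. -/
def vPost₁ {D : ℕ} (w : Sph D) (v₁ v : Space D) : Space D :=
  v₁ - inner ℝ (w : Space D) (v₁ - v) • (w : Space D)

/-- `∫ b(ω, z) dω`. -/
def bBar {D : ℕ} (b : Sph D → Space D → ℝ) (z : Space D) : ℝ≥0∞ :=
  ∫⁻ w, ENNReal.ofReal (b w z) ∂(sphereMeasure D)

/-- The attenuation coefficient `a(v) = ∬ b(ω, v₁ - v) dω M₁ dv₁`. -/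
def attenuation {D : ℕ} (b : Sph D → Space D → ℝ) (v : Space D) : ℝ≥0∞ :=
  ∫⁻ v₁, bBar b (v₁ - v) ∂(maxw D)

/-- The measure `a M dv`. -/
def aMaxw {D : ℕ} (b : Sph D → Space D → ℝ) : Measure (Space D) :=
  (maxw D).withDensity (attenuation b)

/-- The gain operator
`(K⁺ g)(v) = (2a(v))⁻¹ ∬ (g(v') + g(v₁')) b(w, v₁ - v) dw M₁ dv₁`. -/
def gainOp {D : ℕ} (b : Sph D → Space D → ℝ) (g : Space D → ℝ) (v : Space D) : ℝ :=
  (2 * (attenuation b v).toReal)⁻¹ *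
    ∫ p : Sph D × Space D, (g (vPost p.1 p.2 v) + g (vPost₁ p.1 p.2 v)) * b p.1 (p.2 - v)
      ∂((sphereMeasure D).prod (maxw D))

/-- The measure `dμ = b(ω, v₁ - v) dω M₁ dv₁ M dv`, points being written `(ω, v₁, v)`. -/
def collMeasure {D : ℕ} (b : Sph D → Space D → ℝ) : Measure (Sph D × Space D × Space D) :=
  ((sphereMeasure D).prod ((maxw D).prod (maxw D))).withDensity
    fun p => ENNReal.ofReal (b p.1 (p.2.1 - p.2.2))

/-- The assumptions on the collision kernel `b(ω, v₁ - v)`. -/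
structure IsCollisionKernel {D : ℕ} (b : Sph D → Space D → ℝ) : Prop where
  /-- `b` is positive almost everywhere. -/
  pos : ∀ᵐ p ∂((sphereMeasure D).prod (volume : Measure (Space D))), 0 < b p.1 p.2
  /-- The classical form `b(ω, z) = |z| Σ(|ω·z/|z||, |z|)`. -/
  form : ∃ S : ℝ → ℝ → ℝ, Measurable (Function.uncurry S) ∧
    ∀ (w : Sph D) (z : Space D),
      b w z = ‖z‖ * S |inner ℝ (w : Space D) (‖z‖⁻¹ • z)| ‖z‖
  /-- First assumption: local integrability and the growth condition of DiPerna and Lions. -/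
  locInt : LocallyIntegrable
    (fun p : Sph D × Space D × Space D => b p.1 (p.2.1 - p.2.2))
    ((sphereMeasure D).prod ((maxw D).prod (maxw D)))
  growth : ∀ K : Set (Space D), IsCompact K →
    Tendsto (fun v => (∫⁻ v₁ in K, bBar b (v₁ - v)) / ENNReal.ofReal (1 + ‖v‖ ^ 2))
      (cocompact (Space D)) (𝓝 0)
  /-- Second assumption: lower bound on the attenuation coefficient. -/
  lower : ∃ Ca : ℝ, 0 < Ca ∧ ∃ βa : ℝ, ∀ v : Space D,
    ENNReal.ofReal (Ca * (1 + ‖v‖ ^ 2) ^ βa) ≤ attenuation b v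
  /-- Third assumption: a uniform `L^s(a M₁ dv₁)` bound for some `s ∈ (1, ∞]`. -/
  upper : ∃ s : ℝ≥0∞, 1 < s ∧ ∃ Cb : ℝ, 0 < Cb ∧ ∀ v : Space D,
    eLpNorm (fun v₁ => bBar b (v₁ - v) / (attenuation b v₁ * attenuation b v)) s (aMaxw b)
      ≤ ENNReal.ofReal Cb
  /-- Fourth assumption: the gain operator is compact on `L²(a M dv)`. -/
  compact : ∃ T : Lp ℝ 2 (aMaxw b) →L[ℝ] Lp ℝ 2 (aMaxw b), IsCompactOperator T ∧
    ∀ g : Lp ℝ 2 (aMaxw b), T g =ᵐ[aMaxw b] gainOp b g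
  /-- Fifth assumption: the saturated bound. -/
  saturated : ∀ δ : ℝ, 0 < δ → ∃ C : ℝ, ∀ v₁ v : Space D,
    bBar b (v₁ - v) /
        (1 + ENNReal.ofReal δ * (bBar b (v₁ - v) / ENNReal.ofReal (1 + ‖v₁ - v‖ ^ 2)))
      ≤ ENNReal.ofReal C * (1 + attenuation b v₁) * (1 + attenuation b v)
  /-- Normalization: `μ` has total mass one. -/
  normalized : collMeasure b univ = 1

/-- The integrand `(g(v₁') g(v') - g(v₁) g(v)) b(ω, v₁ - v)` of the collision operator. -/
def collisionIntegrand {D : ℕ} (b : Sph D → Space D → ℝ) (g : Space D → ℝ) (v : Space D)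
    (p : Sph D × Space D) : ℝ :=
  (g (vPost₁ p.1 p.2 v) * g (vPost p.1 p.2 v) - g p.2 * g v) * b p.1 (p.2 - v)

/-- The collision operator `Q(g, g)(v)`, the integral against `dω M₁ dv₁`. -/
def collision {D : ℕ} (b : Sph D → Space D → ℝ) (g : Space D → ℝ) (v : Space D) : ℝ :=
  ∫ p, collisionIntegrand b g v p ∂((sphereMeasure D).prod (maxw D))

/-! ### Entropy functionals -/

/-- `η(z) = z log z - z + 1`, with `η(0) = 1`. -/
def eta (z : ℝ) : ℝ := z * Real.log z - z + 1

/-- The relative entropy `H(G) = ∫_Ω ⟨η(G)⟩ dx`. -/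
def relEntropy {D : ℕ} (Ω : Set (Space D)) (G : Space D × Space D → ℝ) : ℝ≥0∞ :=
  ∫⁻ z, ENNReal.ofReal (eta (G z)) ∂(phase Ω)

open Classical in
/-- `log(p/q) (p - q)` for nonnegative `p`, `q`, with value `0` if `p = q` and `∞` if exactly one
of them is zero. -/
def entropyProduction (p q : ℝ) : ℝ≥0∞ :=
  if p = q then 0
  else if p ≤ 0 ∨ q ≤ 0 then ⊤
  else ENNReal.ofReal (Real.log (p / q) * (p - q))

/-- The entropy dissipation rate
`R(G) = (1/4) ∫_Ω ⟪log(G₁'G'/(G₁G)) (G₁'G' - G₁G)⟫ dx`. -/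
def dissipationRate {D : ℕ} (Ω : Set (Space D)) (b : Sph D → Space D → ℝ)
    (G : Space D × Space D → ℝ) : ℝ≥0∞ :=
  (1 / 4) * ∫⁻ x in Ω, ∫⁻ p,
    entropyProduction (G (vPost₁ p.1 p.2.1 p.2.2, x) * G (vPost p.1 p.2.1 p.2.2, x))
      (G (p.2.1, x) * G (p.2.2, x)) ∂(collMeasure b)

/-- The diffuse reflection `⟨φ⟩_{∂Ω}(x) = √(2π) ∫_{v·n(x) > 0} φ(v) v·n(x) M dv` of a nonnegative
function `φ` of `v`, with values in `[0, ∞]`. Only the outgoing part of `φ` enters. -/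
def diffuse {D : ℕ} (Ω : Set (Space D)) (x : Space D) (φ : Space D → ℝ) : ℝ≥0∞ :=
  ENNReal.ofReal (Real.sqrt (2 * Real.pi)) *
    ∫⁻ v in {v : Space D | 0 < inner ℝ v (outwardNormal Ω x)},
      ENNReal.ofReal (φ v) * ENNReal.ofReal (inner ℝ v (outwardNormal Ω x)) ∂(maxw D)

/-- The Darrozès–Guiraud information
`∫_{∂Ω} [⟨η(γ₊G)⟩_{∂Ω} - η(⟨γ₊G⟩_{∂Ω})] dσ`, in which the bracket is nonnegative by Jensen's
inequality. If `⟨γ₊G⟩_{∂Ω} = ∞` then also `⟨η(γ₊G)⟩_{∂Ω} = ∞`, and the bracket below is `∞`. -/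
def dgInformation {D : ℕ} (Ω : Set (Space D)) (γG : Space D × Space D → ℝ) : ℝ≥0∞ :=
  ∫⁻ x, (diffuse Ω x (fun v => eta (γG (v, x)))
    - ENNReal.ofReal (eta (diffuse Ω x (fun v => γG (v, x))).toReal)) ∂(surfaceMeasure Ω)

/-- The specular reflection `R(x) v = v - 2 (v·n(x)) n(x)`. -/
def reflect {D : ℕ} (Ω : Set (Space D)) (x v : Space D) : Space D :=
  v - (2 * inner ℝ v (outwardNormal Ω x)) • outwardNormal Ω x

/-! ### Renormalized solutions -/

/-- Admissible renormalizations: `Γ ∈ C¹([0,∞))` with `|Γ'(Z)| ≤ C / √(1+Z)`. -/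
def IsAdmissible (Γ : ℝ → ℝ) : Prop :=
  ContDiffOn ℝ 1 Γ (Ici 0) ∧
    ∃ C : ℝ, ∀ Z : ℝ, 0 ≤ Z → |derivWithin Γ (Ici 0) Z| ≤ C / Real.sqrt (1 + Z)

/-- `v · ∇ₓ Y (v, x)`. -/
def transport {D : ℕ} (Y : Space D × Space D → ℝ) (z : Space D × Space D) : ℝ :=
  fderiv ℝ (fun x => Y (z.1, x)) z.2 z.1

/-- `G` (a function of `t` and of `(v, x)`), with trace `γG` on the boundary of the phase space,
is a DiPerna–Lions–Mischler renormalized solution of the Boltzmann equation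
`∂ₜ G + v·∇ₓ G = ε⁻¹ Q(G, G)` on `Ω` with initial value `Gin` and with the Maxwell reflection
boundary condition with accommodation coefficient `α`. -/
structure IsRenormalizedSolution {D : ℕ} (Ω : Set (Space D)) (b : Sph D → Space D → ℝ)
    (α ε : ℝ) (Gin : Space D × Space D → ℝ)
    (G γG : ℝ → Space D × Space D → ℝ) : Prop where
  /-- `G ≥ 0` lies in `C([0,∞); w-L¹(M dv dx))`. -/
  measurable : AEStronglyMeasurable (fun p : ℝ × Space D × Space D => G p.1 p.2)
    ((volume.restrict (Ioi 0)).prod (phase Ω))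
  nonneg : ∀ t : ℝ, 0 ≤ t → ∀ᵐ z ∂(phase Ω), 0 ≤ G t z
  integrable : ∀ t : ℝ, 0 ≤ t → Integrable (G t) (phase Ω)
  weakly_continuous : ∀ φ : Space D × Space D → ℝ, Measurable φ → (∃ C : ℝ, ∀ z, |φ z| ≤ C) →
    ContinuousOn (fun t => ∫ z, G t z * φ z ∂(phase Ω)) (Ici 0)
  initial : G 0 =ᵐ[phase Ω] Gin
  /-- The trace is a nonnegative finite measurable function on the boundary. -/
  trace_measurable : AEStronglyMeasurable
    (fun p : ℝ × Space D × Space D => γG p.1 (p.2.2, p.2.1)) (boundaryTime Ω (Ioi 0))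
  trace_nonneg : ∀ᵐ p ∂(boundaryTime Ω (Ioi 0)), 0 ≤ γG p.1 (p.2.2, p.2.1)
  /-- The global entropy inequality. -/
  entropy : ∀ t : ℝ, 0 < t →
    relEntropy Ω (G t) +
      ∫⁻ s in Ioc 0 t, (ENNReal.ofReal (1 / ε) * dissipationRate Ω b (G s)
        + ENNReal.ofReal (α / Real.sqrt (2 * Real.pi)) * dgInformation Ω (γG s))
      ≤ relEntropy Ω Gin
  /-- The integral defining `Q(G, G)` converges absolutely almost everywhere. -/
  collision_integrable : ∀ᵐ p ∂((volume.restrict (Ioi 0)).prod (phase Ω)),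
    Integrable (collisionIntegrand b (fun w => G p.1 (w, p.2.2)) p.2.1)
      ((sphereMeasure D).prod (maxw D))
  /-- The renormalized Boltzmann equation in weak form, for every admissible `Γ` and every bounded
  test function `Y ∈ C¹` on `ℝ^D × closure Ω` whose transport term is integrable: the remaining
  terms are integrable, and the identity holds. -/
  weak_form : ∀ Γ : ℝ → ℝ, IsAdmissible Γ →
    ∀ Y : Space D × Space D → ℝ, ContDiffOn ℝ 1 Y (univ ×ˢ closure Ω) →
      (∃ C : ℝ, ∀ v : Space D, ∀ x ∈ closure Ω, |Y (v, x)| ≤ C) →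
    ∀ t₁ t₂ : ℝ, 0 ≤ t₁ → t₁ ≤ t₂ →
      Integrable (fun p : ℝ × Space D × Space D => Γ (G p.1 p.2) * transport Y p.2)
        ((volume.restrict (Ioc t₁ t₂)).prod (phase Ω)) →
      Integrable (fun p : ℝ × Space D × Space D =>
          Γ (γG p.1 (p.2.2, p.2.1)) * Y (p.2.2, p.2.1)
            * inner ℝ p.2.2 (outwardNormal Ω p.2.1)) (boundaryTime Ω (Ioc t₁ t₂)) ∧
      Integrable (fun p : ℝ × Space D × Space D =>
          derivWithin Γ (Ici 0) (G p.1 p.2)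
            * collision b (fun w => G p.1 (w, p.2.2)) p.2.1 * Y p.2)
        ((volume.restrict (Ioc t₁ t₂)).prod (phase Ω)) ∧
      (∀ t : ℝ, 0 ≤ t → Integrable (fun z => Γ (G t z) * Y z) (phase Ω)) ∧
      ((∫ z, Γ (G t₂ z) * Y z ∂(phase Ω)) - (∫ z, Γ (G t₁ z) * Y z ∂(phase Ω))
          + (∫ t in t₁..t₂, ∫ x, ∫ v,
              Γ (γG t (v, x)) * Y (v, x) * inner ℝ v (outwardNormal Ω x)
                ∂(maxw D) ∂(surfaceMeasure Ω))
          - (∫ t in t₁..t₂, ∫ z, Γ (G t z) * transport Y z ∂(phase Ω))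
        = (1 / ε) * ∫ t in t₁..t₂, ∫ z,
            derivWithin Γ (Ici 0) (G t z) * collision b (fun w => G t (w, z.2)) z.1 * Y z
              ∂(phase Ω))
  /-- The Maxwell reflection boundary condition
  `γ₋G = (1 - α) L(γ₊G) + α ⟨γ₊G⟩_{∂Ω}`, almost everywhere on the incoming set. -/
  boundary_condition : ∀ᵐ p ∂(boundaryTime Ω (Ioi 0)),
    inner ℝ p.2.2 (outwardNormal Ω p.2.1) < 0 →
      ENNReal.ofReal (γG p.1 (p.2.2, p.2.1))
        = ENNReal.ofReal (1 - α) * ENNReal.ofReal (γG p.1 (reflect Ω p.2.1 p.2.2, p.2.1))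
          + ENNReal.ofReal α * diffuse Ω p.2.1 (fun v => γG p.1 (v, p.2.1))

/-- `Gin` belongs to the entropy class `E(M dv dx)`. -/
def InEntropyClass {D : ℕ} (Ω : Set (Space D)) (Gin : Space D × Space D → ℝ) : Prop :=
  AEStronglyMeasurable Gin (phase Ω) ∧ (∀ᵐ z ∂(phase Ω), 0 ≤ Gin z) ∧ relEntropy Ω Gin < ⊤

/-- The renormalization `Γ(Z) = (Z - 1) / (1 + (Z - 1)²)`. -/
def renorm (Z : ℝ) : ℝ := (Z - 1) / (1 + (Z - 1) ^ 2)

/-- The boundary mass-flux term `∫_{t₁}^{t₂} ∫_{∂Ω} χ ⟨v γg̃⟩·n dσ dt`, where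
`γg̃ = Γ(γG) / δ`. -/
def boundaryMassFlux {D : ℕ} (Ω : Set (Space D)) (δ : ℝ) (γG : ℝ → Space D × Space D → ℝ)
    (χ : Space D → ℝ) (t₁ t₂ : ℝ) : ℝ :=
  ∫ t in t₁..t₂, ∫ x,
    χ x * inner ℝ (∫ v, (renorm (γG t (v, x)) / δ) • v ∂(maxw D)) (outwardNormal Ω x)
      ∂(surfaceMeasure Ω)

end

end AcousticLimit

/-! ### Gaussian facts about `M dv`: marginals, reflection invariance, half-space flux. -/

namespace AcousticLimit

/-! Write Γ for `renorm`. Fix a boundary point and a time, let X be the trace as a function of v,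
and let A be its diffuse average. Reflecting the incoming velocities and inserting the Maxwell law
turns the mass flux of Γ(X) into the outgoing integral of [Γ(X) - Γ((1-α)X + αA)] (v·n) M
(`integral_renorm_mul_inner_eq`).

Expand both values of Γ at A. The first-order terms leave αΓ'(A)(X - A), which integrates to zero
because A is the mean of X for the probability measure √(2π)(v·n)M dv on outgoing velocities. The
remainders are at most 16 times the relative entropy density X log(X/A) - X + A
(`abs_renorm_reflection_defect_le`). Up to the factor √(2π), the integral of that density is the
Darrozès–Guiraud bracket (`integral_relEta_mul_inner`).

For α > 0 the entropy inequality bounds the time integral of the Darrozès–Guiraud information by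
√(2π)/α times the initial entropy, which is O(δ²). After division by δ, the flux is O(δ). For α = 0
reflection is specular and the flux vanishes identically.

Smoothness of the boundary supplies a continuous unit normal and a finite surface measure, which
justify Fubini and the integrability claim. -/

open ProbabilityTheory Complex in
/-- The measure `M dv` is the standard Gaussian measure. -/
lemma maxw_eq_stdGaussian (D : ℕ) : maxw D = stdGaussian (Space D) := by
  have hmeas : Measurable fun v : Space D => ENNReal.ofReal (maxwellian v) := by
    unfold maxwellian; fun_prop
  have hint : Integrable (fun v : Space D => maxwellian v) := by
    -- A non-integrable function has integral 0 by convention, so the nonzero Gaussian integral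
    -- itself proves integrability.
    have h : Integrable fun v : Space D => Real.exp (-(1 / 2) * ‖v‖ ^ 2) :=
      not_imp_comm.1 integral_undef (by
        rw [GaussianFourier.integral_rexp_neg_mul_sq_norm (by norm_num)]; positivity)
    convert! h.const_mul ((2 * Real.pi) ^ (-(D : ℝ) / 2)) using 2 with v
    unfold maxwellian
    ring_nf
  have : IsFiniteMeasure (maxw D) := isFiniteMeasure_withDensity_ofReal hint.2
  refine Measure.ext_of_charFun (funext fun t => ?_)
  rw [charFun_stdGaussian, charFun_apply, maxw,
    integral_withDensity_eq_integral_toReal_smul hmeas (by simp)]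
  have hpt : ∀ v : Space D, (ENNReal.ofReal (maxwellian v)).toReal • cexp (inner ℝ v t * I)
      = (((2 * Real.pi) ^ (-(D : ℝ) / 2) : ℝ) : ℂ)
        * cexp (-(1 / 2 : ℂ) * ‖v‖ ^ 2 + I * (inner ℝ t v : ℝ)) := by
    intro v
    have h0 : 0 ≤ maxwellian v := by unfold maxwellian; positivity
    rw [ENNReal.toReal_ofReal h0, Complex.real_smul, maxwellian, ofReal_mul, ofReal_exp,
      mul_assoc, ← Complex.exp_add, real_inner_comm t v]
    push_cast
    ring_nf
  simp_rw [hpt]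
  rw [integral_const_mul, GaussianFourier.integral_cexp_neg_mul_sq_norm_add (by norm_num) I t]
  rw [← mul_assoc]
  have hc : (((2 * Real.pi) ^ (-(D : ℝ) / 2) : ℝ) : ℂ)
      * ((Real.pi : ℂ) / (1 / 2 : ℂ)) ^ ((Module.finrank ℝ (Space D) : ℂ) / 2) = 1 := by
    have h1 : ((Real.pi : ℂ) / (1 / 2 : ℂ)) ^ ((Module.finrank ℝ (Space D) : ℂ) / 2)
        = (((2 * Real.pi) ^ ((D : ℝ) / 2) : ℝ) : ℂ) := by
      rw [ofReal_cpow (by positivity)]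
      simp only [finrank_euclideanSpace, Fintype.card_fin]
      push_cast
      congr 1
      ring
    rw [h1, ← ofReal_mul, ← Real.rpow_add (by positivity)]
    simp [neg_div]
  rw [hc, one_mul]
  congr 1
  rw [I_sq]
  ring

instance instIsProbabilityMeasureMaxw (D : ℕ) : IsProbabilityMeasure (maxw D) := by
  rw [maxw_eq_stdGaussian]; infer_instance

open ProbabilityTheory in
lemma integrable_norm_maxw (D : ℕ) : Integrable (fun v : Space D => ‖v‖) (maxw D) := by
  rw [maxw_eq_stdGaussian]
  exact (IsGaussian.integrable_id (μ := stdGaussian (Space D))).norm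

lemma integrable_inner_maxw {D : ℕ} (n : Space D) :
    Integrable (fun v : Space D => inner ℝ v n) (maxw D) := by
  refine ((integrable_norm_maxw D).mul_const ‖n‖).mono' (by fun_prop) (.of_forall fun v => ?_)
  exact norm_inner_le_norm v n

open ProbabilityTheory in
lemma map_inner_maxw {D : ℕ} {n : Space D} (hn : ‖n‖ = 1) :
    (maxw D).map (fun v => inner ℝ v n) = gaussianReal 0 1 := by
  have h : (fun v : Space D => (inner ℝ v n : ℝ)) = innerSL ℝ n := by
    ext v; simp [real_inner_comm]
  rw [maxw_eq_stdGaussian, h, IsGaussian.map_eq_gaussianReal, variance_dual_stdGaussian,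
    integral_strongDual_stdGaussian, innerSL_apply_norm, hn]
  simp

/-- The reflection in the hyperplane orthogonal to a unit vector preserves `M dv`. -/
lemma measurePreserving_reflection_maxw {D : ℕ} {n : Space D} (hn : ‖n‖ = 1) :
    MeasurePreserving (fun v : Space D => v - (2 * inner ℝ v n) • n) (maxw D) (maxw D) := by
  have h : (fun v : Space D => v - (2 * (inner ℝ v n : ℝ)) • n)
      = (Submodule.span ℝ {n})ᗮ.reflection := by
    ext1 v
    rw [Submodule.reflection_orthogonal_apply, Submodule.reflection_singleton_apply]
    simp only [hn, real_inner_comm, RCLike.ofReal_real_eq_id, id]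
    module
  rw [h]
  refine ⟨(LinearIsometryEquiv.continuous _).measurable, ?_⟩
  rw [maxw_eq_stdGaussian]
  exact ProbabilityTheory.stdGaussian_map _

open ProbabilityTheory in
lemma integral_gaussianReal_Ioi : ∫ x in Ioi (0 : ℝ), x ∂(gaussianReal 0 1)
    = (Real.sqrt (2 * Real.pi))⁻¹ := by
  rw [gaussianReal_of_var_ne_zero _ one_ne_zero, restrict_withDensity measurableSet_Ioi,
    integral_withDensity_eq_integral_toReal_smul (measurable_gaussianPDF _ _)
      (.of_forall fun _ => gaussianPDF_lt_top)]
  simp only [toReal_gaussianPDF, gaussianPDFReal, smul_eq_mul]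
  have h := integral_rpow_mul_exp_neg_mul_rpow (p := 2) (q := 1) (b := 1 / 2)
    (by norm_num) (by norm_num) (by norm_num)
  have h2 : ∀ x ∈ Ioi (0 : ℝ), (Real.sqrt (2 * Real.pi * (1 : NNReal)))⁻¹
      * Real.exp (-(x - 0) ^ 2 / (2 * (1 : NNReal))) * x
      = (Real.sqrt (2 * Real.pi))⁻¹ * (x ^ (1 : ℝ) * Real.exp (-(1 / 2) * x ^ (2 : ℝ))) := by
    intro x _
    rw [Real.rpow_one, Real.rpow_two]
    simp only [NNReal.coe_one, mul_one, sub_zero]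
    ring_nf
  rw [setIntegral_congr_fun measurableSet_Ioi h2, integral_const_mul, h]
  norm_num

/-- Only the marginal of `M dv` along n matters, and it is a standard Gaussian. This value makes
√(2π)(v·n)M dv a probability measure on the outgoing half-space. -/
lemma integral_inner_halfspace_maxw {D : ℕ} {n : Space D} (hn : ‖n‖ = 1) :
    ∫ v in {v : Space D | 0 < inner ℝ v n}, inner ℝ v n ∂(maxw D)
      = (Real.sqrt (2 * Real.pi))⁻¹ := by
  rw [← integral_gaussianReal_Ioi, ← map_inner_maxw hn,
    setIntegral_map measurableSet_Ioi (by fun_prop) (by fun_prop)]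
  rfl

/-- Reflection exchanges the two open half-spaces, and a null outgoing half-space would carry no
flux. The fact provides an incoming velocity at which an almost-everywhere boundary law can be read
off. -/
lemma maxw_incoming_ne_zero {D : ℕ} {n : Space D} (hn : ‖n‖ = 1) :
    maxw D {v : Space D | inner ℝ v n < 0} ≠ 0 := by
  intro h
  have hp : MeasurePreserving (fun v : Space D => v - (2 * inner ℝ v n) • n) (maxw D) (maxw D) :=
    measurePreserving_reflection_maxw hn
  have hm : MeasurableSet {v : Space D | inner ℝ v n < 0} :=
    measurableSet_lt (by fun_prop) (by fun_prop)
  have h2 := hp.measure_preimage hm.nullMeasurableSet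
  rw [h] at h2
  have h3 : (fun v : Space D => v - (2 * inner ℝ v n) • n) ⁻¹' {v : Space D | inner ℝ v n < 0}
      = {v : Space D | 0 < inner ℝ v n} := by
    ext v
    simp only [mem_preimage, mem_ofPred_eq, inner_sub_left, inner_smul_left, real_inner_self_eq_norm_sq,
      hn, RCLike.conj_to_real]
    constructor <;> intro <;> linarith
  rw [h3] at h2
  have h4 := integral_inner_halfspace_maxw hn
  rw [Measure.restrict_eq_zero.2 h2, integral_zero_measure] at h4
  have : 0 < (Real.sqrt (2 * Real.pi))⁻¹ := by positivity
  linarith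

end AcousticLimit

/-! ### Pointwise inequalities: Taylor remainders of `renorm` against relative entropy. -/

namespace AcousticLimit

lemma renorm_abs_le (Z : ℝ) : |renorm Z| ≤ 1 := by
  unfold renorm
  rw [abs_div, abs_of_pos (by positivity : 0 < 1 + (Z - 1) ^ 2), div_le_one (by positivity)]
  exact abs_le.2 ⟨by nlinarith [sq_nonneg (Z - 1 + 1)], by nlinarith [sq_nonneg (Z - 1 - 1)]⟩

lemma measurable_renorm : Measurable renorm := by
  unfold renorm; fun_prop

/-- The derivative of `renorm`. -/
noncomputable def renormDeriv (A : ℝ) : ℝ := (1 - (A - 1) ^ 2) / (1 + (A - 1) ^ 2) ^ 2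

/-- The relative entropy density `Z log (Z / A) - Z + A`. -/
noncomputable def relEta (A Z : ℝ) : ℝ := Z * Real.log Z - Z * Real.log A - Z + A

/-- With p = √Z and q = √A the density is 2p² log(p/q) - p² + q², and log(p/q) ≥ 1 - q/p. -/
lemma sq_sqrt_sub_le_relEta {A Z : ℝ} (hA : 0 < A) (hZ : 0 ≤ Z) :
    (Real.sqrt Z - Real.sqrt A) ^ 2 ≤ relEta A Z := by
  rcases hZ.eq_or_lt with rfl | hZ
  · simp [relEta, Real.sq_sqrt hA.le]
  obtain ⟨p, hp, rfl⟩ : ∃ p, 0 < p ∧ Z = p ^ 2 := ⟨√Z, by positivity, (Real.sq_sqrt hZ.le).symm⟩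
  obtain ⟨q, hq, rfl⟩ : ∃ p, 0 < p ∧ A = p ^ 2 := ⟨√A, by positivity, (Real.sq_sqrt hA.le).symm⟩
  have h := Real.one_sub_inv_le_log_of_pos (div_pos hp hq)
  rw [Real.log_div hp.ne' hq.ne'] at h
  have h2 : p ^ 2 * (1 - (p / q)⁻¹) = p ^ 2 - p * q := by field_simp
  have h3 := mul_le_mul_of_nonneg_left h (sq_nonneg p)
  rw [h2] at h3
  rw [Real.sqrt_sq hp.le, Real.sqrt_sq hq.le, relEta, Real.log_pow, Real.log_pow]
  push_cast
  nlinarith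

/-- Factor Z - A through square roots. The price of a quadratic bound is the weight Z + A, which the
decay of `renorm` later absorbs. -/
lemma sq_sub_le_relEta {A Z : ℝ} (hA : 0 < A) (hZ : 0 ≤ Z) :
    (Z - A) ^ 2 ≤ 2 * (Z + A) * relEta A Z := by
  have h := sq_sqrt_sub_le_relEta hA hZ
  have h1 := Real.sq_sqrt hA.le
  have h2 := Real.sq_sqrt hZ
  have h3 : (Z - A) ^ 2 = (√Z - √A) ^ 2 * (√Z + √A) ^ 2 := by
    rw [← mul_pow, ← h1, ← h2, Real.sqrt_sq (Real.sqrt_nonneg _), Real.sqrt_sq (Real.sqrt_nonneg _)]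
    ring
  have h4 : (√Z + √A) ^ 2 ≤ 2 * (Z + A) := by nlinarith [sq_nonneg (√Z - √A)]
  rw [h3, mul_comm]
  exact mul_le_mul h4 h (sq_nonneg _) (by positivity)

lemma relEta_nonneg {A Z : ℝ} (hA : 0 < A) (hZ : 0 ≤ Z) : 0 ≤ relEta A Z :=
  (sq_nonneg _).trans (sq_sqrt_sub_le_relEta hA hZ)

/-- Convexity in Z, together with vanishing at Z = A. It lets the entropy density at Z also control
the remainder at the reflected value. -/
lemma relEta_convexComb_le {A Z α : ℝ} (hZ : 0 ≤ Z) (hA : 0 < A) (h0 : 0 ≤ α)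
    (h1 : α ≤ 1) : relEta A ((1 - α) * Z + α * A) ≤ (1 - α) * relEta A Z := by
  have h := Real.convexOn_mul_log.2 (mem_Ici.2 hZ) (mem_Ici.2 hA.le) (sub_nonneg.2 h1) h0 (by ring)
  simp only [smul_eq_mul] at h
  unfold relEta
  linarith

/-- The second order Taylor remainder of `renorm` is controlled by the relative entropy density. -/
lemma abs_renorm_taylor_le {A Z : ℝ} (hA : 0 < A) (hZ : 0 ≤ Z) :
    |renorm Z - renorm A - renormDeriv A * (Z - A)| ≤ 8 * relEta A Z := by
  have hk := sq_sub_le_relEta hA hZ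
  have hk0 := relEta_nonneg hA hZ
  obtain ⟨a, rfl⟩ : ∃ a, A = 1 + a := ⟨A - 1, by ring⟩
  obtain ⟨b, rfl⟩ : ∃ a, Z = 1 + a := ⟨Z - 1, by ring⟩
  -- The remainder is an exact rational function with (b - a)² as a factor, so the quadratic entropy
  -- bound applies directly.
  have e : renorm (1 + b) - renorm (1 + a) - renormDeriv (1 + a) * (1 + b - (1 + a))
      = (b - a) ^ 2 * (a ^ 2 * b - 2 * a - b) / ((1 + a ^ 2) ^ 2 * (1 + b ^ 2)) := by
    unfold renorm renormDeriv
    simp only [add_sub_cancel_left]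
    have : 1 + a ^ 2 ≠ 0 := by positivity
    have : 1 + b ^ 2 ≠ 0 := by positivity
    field_simp
    ring
  rw [e, abs_div, abs_mul, abs_of_nonneg (sq_nonneg (b - a)),
    abs_of_pos (by positivity : 0 < (1 + a ^ 2) ^ 2 * (1 + b ^ 2)), div_le_iff₀ (by positivity)]
  have h1 : |a ^ 2 * b - 2 * a - b| ≤ (1 + a ^ 2) * (1 + |b|) := by
    have : |a ^ 2 * b - 2 * a - b| ≤ a ^ 2 * |b| + 2 * |a| + |b| := by
      calc _ ≤ |a ^ 2 * b| + |2 * a| + |b| := (abs_sub _ _).trans (by gcongr; exact abs_sub _ _)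
        _ = _ := by rw [abs_mul, abs_mul, abs_of_nonneg (sq_nonneg a)]; norm_num
    nlinarith [sq_nonneg (|a| - 1), sq_abs a]
  -- The denominator absorbs the weight Z + A. This 4, times the 2 of `sq_sub_le_relEta`, gives the
  -- constant 8.
  have h2 : (1 + |b|) * (1 + b + (1 + a)) ≤ 4 * ((1 + a ^ 2) * (1 + b ^ 2)) := by
    have hx := sq_abs a
    have hy := sq_abs b
    rw [← hx, ← hy]
    have hx' := abs_nonneg a
    have hy' := abs_nonneg b
    have : (1 + |b|) * (1 + b + (1 + a)) ≤ (1 + |b|) * (2 + |a| + |b|) := by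
      exact mul_le_mul_of_nonneg_left (by linarith [le_abs_self a, le_abs_self b]) (by positivity)
    refine this.trans ?_
    generalize |a| = x at *
    generalize |b| = y at *
    have h3 : (1 + y) * (1 + y) ≤ 2 * ((1 + x ^ 2) * (1 + y ^ 2)) := by
      nlinarith [sq_nonneg (y - 1), sq_nonneg (x * y), sq_nonneg x]
    have h4 : (1 + y) * (1 + x) ≤ 2 * ((1 + x ^ 2) * (1 + y ^ 2)) := by
      nlinarith [sq_nonneg (x - y), sq_nonneg (x * y), sq_nonneg (x - 1), sq_nonneg (y - 1),
        sq_nonneg (x * y - 1)]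
    nlinarith
  have hab : 0 ≤ 1 + b + (1 + a) := by linarith
  calc (b - a) ^ 2 * |a ^ 2 * b - 2 * a - b|
      ≤ (2 * (1 + b + (1 + a)) * relEta (1 + a) (1 + b)) * ((1 + a ^ 2) * (1 + |b|)) := by
        refine mul_le_mul ?_ h1 (abs_nonneg _) (by positivity)
        calc _ = (1 + b - (1 + a)) ^ 2 := by ring
          _ ≤ _ := hk
    _ = 2 * relEta (1 + a) (1 + b) * (1 + a ^ 2) * ((1 + |b|) * (1 + b + (1 + a))) := by ring
    _ ≤ 2 * relEta (1 + a) (1 + b) * (1 + a ^ 2) * (4 * ((1 + a ^ 2) * (1 + b ^ 2))) := by gcongr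
    _ = _ := by ring

/-- The nonlinear defect of the Maxwell reflection law under `renorm` is, up to a linear term,
controlled by the relative entropy density. -/
lemma abs_renorm_reflection_defect_le {A Z α : ℝ} (hA : 0 < A) (hZ : 0 ≤ Z) (h0 : 0 ≤ α)
    (h1 : α ≤ 1) :
    |renorm Z - renorm ((1 - α) * Z + α * A) - α * renormDeriv A * (Z - A)|
      ≤ 16 * relEta A Z := by
  have hY : 0 ≤ (1 - α) * Z + α * A := by
    have := sub_nonneg.2 h1
    positivity
  have e1 := abs_le.1 (abs_renorm_taylor_le hA hZ)
  have e2 := abs_le.1 (abs_renorm_taylor_le hA hY)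
  have e3 := relEta_convexComb_le hZ hA h0 h1
  have e4 : (1 - α) * relEta A Z ≤ relEta A Z := by nlinarith [relEta_nonneg hA hZ]
  -- The reflected deviation is (1-α)(Z - A), so subtracting the two expansions leaves the linear
  -- term with factor α and two remainders, 8 + 8 = 16.
  have e5 : renormDeriv A * ((1 - α) * Z + α * A - A)
      = renormDeriv A * (Z - A) - α * renormDeriv A * (Z - A) := by ring
  rw [e5] at e2
  exact abs_le.2 ⟨by linarith [e1.1, e2.2], by linarith [e1.2, e2.1]⟩

end AcousticLimit

/-! ### Geometry of the boundary: outward normal and finiteness of the surface measure. -/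

namespace AcousticLimit

namespace IsLocalDefiningFunction

variable {D : ℕ} {Ω : Set (Space D)} {p : Space D} {ρ ρ' : Space D → ℝ}

lemma contDiffAt (h : IsLocalDefiningFunction Ω p ρ) : ContDiffAt ℝ ∞ ρ p := by
  obtain ⟨-, U, hU, hp, hρ, -⟩ := h
  exact hρ.contDiffAt (hU.mem_nhds hp)

lemma eventually_mem_iff (h : IsLocalDefiningFunction Ω p ρ) :
    ∀ᶠ x in 𝓝 p, (x ∈ Ω ↔ ρ x < 0) := by
  obtain ⟨-, U, hU, hp, -, hiff⟩ := h
  filter_upwards [hU.mem_nhds hp] with x hx using hiff x hx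

lemma eq_zero (h : IsLocalDefiningFunction Ω p ρ) (hΩ : IsOpen Ω) (hp : p ∈ frontier Ω) :
    ρ p = 0 := by
  have hiff := h.eventually_mem_iff
  refine le_antisymm (not_lt.1 fun hpos => ?_) (not_lt.1 fun hneg => ?_)
  · have h1 : ∀ᶠ x in 𝓝 p, 0 < ρ x := h.contDiffAt.continuousAt.eventually (lt_mem_nhds hpos)
    obtain ⟨x, hx, hxΩ⟩ := mem_closure_iff_nhds.1 hp.1 _ (h1.and hiff)
    exact lt_asymm hx.1 (hx.2.1 hxΩ)
  · rw [hΩ.frontier_eq] at hp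
    exact hp.2 (hiff.self_of_nhds.2 hneg)

/-- A local defining function at a boundary point is one at all nearby boundary points. -/
lemma eventually (h : IsLocalDefiningFunction Ω p ρ) :
    ∀ᶠ x in 𝓝 p, IsLocalDefiningFunction Ω x ρ ∧ ContinuousAt (gradient ρ) x := by
  obtain ⟨hg, U, hU, hp, hρ, hiff⟩ := h
  have hc : ∀ x ∈ U, ContinuousAt (gradient ρ) x := fun x hx =>
    (LinearIsometryEquiv.continuous _).continuousAt.comp
      ((hρ.continuousOn_fderiv_of_isOpen hU (by simp)).continuousAt (hU.mem_nhds hx))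
  filter_upwards [hU.mem_nhds hp, (hc p hp).eventually_ne hg] with x hx hx'
  exact ⟨⟨hx', U, hU, hx, hρ, hiff⟩, hc x hx⟩

lemma tendsto_slope (h : IsLocalDefiningFunction Ω p ρ) (hΩ : IsOpen Ω) (hp : p ∈ frontier Ω)
    (w : Space D) :
    Tendsto (fun s : ℝ => s⁻¹ * ρ (p + s • w)) (𝓝[>] 0) (𝓝 (inner ℝ (gradient ρ p) w)) := by
  have hd : HasFDerivAt ρ (fderiv ℝ ρ p) p :=
    (h.contDiffAt.differentiableAt (by simp)).hasFDerivAt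
  have hl := hd.hasLineDerivAt w
  rw [show inner ℝ (gradient ρ p) w = fderiv ℝ ρ p w by simp [gradient]]
  have := hl.tendsto_slope_zero_right
  simpa [h.eq_zero hΩ hp] using this

/-- A direction along which ρ strictly decreases enters Ω, so ρ' is negative along it and its slope
cannot be positive. -/
lemma inner_gradient_nonpos (h : IsLocalDefiningFunction Ω p ρ)
    (h' : IsLocalDefiningFunction Ω p ρ') (hΩ : IsOpen Ω) (hp : p ∈ frontier Ω) {w : Space D}
    (hw : inner ℝ (gradient ρ p) w < 0) : inner ℝ (gradient ρ' p) w ≤ 0 := by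
  have hline : Tendsto (fun s : ℝ => p + s • w) (𝓝[>] 0) (𝓝 p) := by
    have : Continuous fun s : ℝ => p + s • w := by fun_prop
    simpa using (this.tendsto 0).mono_left nhdsWithin_le_nhds
  refine le_of_tendsto (h'.tendsto_slope hΩ hp w) ?_
  filter_upwards [(h.tendsto_slope hΩ hp w).eventually (gt_mem_nhds hw),
    hline.eventually h.eventually_mem_iff, hline.eventually h'.eventually_mem_iff,
    self_mem_nhdsWithin] with s hs h1 h2 (hs0 : 0 < s)
  have hneg : ρ (p + s • w) < 0 := by
    by_contra! hcon
    exact absurd hs (not_lt.2 (by positivity))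
  exact mul_nonpos_of_nonneg_of_nonpos (by positivity) (h2.1 (h1.2 hneg)).le

/-- If the unit gradients a and b differed, moving along b - a would decrease ρ and increase ρ' to
first order. This removes the arbitrary choice in `outwardNormal`, which continuity requires. -/
lemma normalized_gradient_eq (h : IsLocalDefiningFunction Ω p ρ)
    (h' : IsLocalDefiningFunction Ω p ρ') (hΩ : IsOpen Ω) (hp : p ∈ frontier Ω) :
    ‖gradient ρ p‖⁻¹ • gradient ρ p = ‖gradient ρ' p‖⁻¹ • gradient ρ' p := by
  by_contra hne
  have ha := norm_smul_inv_norm (𝕜 := ℝ) h.1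
  have hb := norm_smul_inv_norm (𝕜 := ℝ) h'.1
  simp only [RCLike.ofReal_real_eq_id, id] at ha hb
  have hlt := (inner_lt_one_iff_real_of_norm_eq_one ha hb).2 hne
  have h0 : 0 < ‖gradient ρ p‖ := norm_pos_iff.2 h.1
  have h0' : 0 < ‖gradient ρ' p‖ := norm_pos_iff.2 h'.1
  set a := ‖gradient ρ p‖⁻¹ • gradient ρ p with ha'
  set b := ‖gradient ρ' p‖⁻¹ • gradient ρ' p with hb'
  have ea : gradient ρ p = ‖gradient ρ p‖ • a := by
    rw [ha', smul_smul, mul_inv_cancel₀ h0.ne', one_smul]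
  have eb : gradient ρ' p = ‖gradient ρ' p‖ • b := by
    rw [hb', smul_smul, mul_inv_cancel₀ h0'.ne', one_smul]
  have key : inner ℝ (gradient ρ p) (b - a) < 0 := by
    rw [ea, real_inner_smul_left, inner_sub_right, real_inner_self_eq_norm_sq, ha]
    exact mul_neg_of_pos_of_neg h0 (by linarith)
  have key' := h.inner_gradient_nonpos h' hΩ hp key
  rw [eb, real_inner_smul_left, inner_sub_right, real_inner_self_eq_norm_sq, hb,
    real_inner_comm] at key'
  exact absurd key' (not_le.2 (mul_pos h0' (by linarith)))

lemma outwardNormal_eq (h : IsLocalDefiningFunction Ω p ρ) (hΩ : IsOpen Ω)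
    (hp : p ∈ frontier Ω) : outwardNormal Ω p = ‖gradient ρ p‖⁻¹ • gradient ρ p := by
  have hex : ∃ ρ : Space D → ℝ, IsLocalDefiningFunction Ω p ρ := ⟨ρ, h⟩
  rw [outwardNormal, dif_pos hex]
  exact hex.choose_spec.normalized_gradient_eq h hΩ hp

/-- Near `p` the orthogonal projection along the normal is antilipschitz on the boundary. -/
lemma exists_antilipschitz (h : IsLocalDefiningFunction Ω p ρ) (hΩ : IsOpen Ω) :
    ∃ V ∈ 𝓝 p, AntilipschitzWith 2
      ((frontier Ω ∩ V).domRestrict (Submodule.span ℝ {gradient ρ p})ᗮ.orthogonalProjectionOnto) := by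
  have hst : HasStrictFDerivAt ρ (fderiv ℝ ρ p) p := h.contDiffAt.hasStrictFDerivAt (by simp)
  have hg : 0 < ‖gradient ρ p‖ := norm_pos_iff.2 h.1
  -- Between two zeros of ρ near p, strict differentiability with tolerance ‖∇ρ(p)‖/2 bounds the
  -- normal component of x - y by half its length. By Pythagoras the tangential part is at least
  -- half of it, whence the constant 2.
  have hlo := hst.isLittleO.def (half_pos hg)
  rw [nhds_prod_eq, eventually_prod_self_iff'] at hlo
  obtain ⟨V, hV, hVρ⟩ := hlo
  refine ⟨V ∩ {x | IsLocalDefiningFunction Ω x ρ}, inter_mem hV (h.eventually.mono fun x hx => hx.1),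
    AntilipschitzWith.of_le_mul_dist fun x y => ?_⟩
  obtain ⟨x, hx, hxV, hxρ⟩ := x
  obtain ⟨y, hy, hyV, hyρ⟩ := y
  have h1 := hVρ x hxV y hyV
  simp only [IsLocalDefiningFunction.eq_zero hxρ hΩ hx, IsLocalDefiningFunction.eq_zero hyρ hΩ hy,
    sub_self, zero_sub, norm_neg] at h1
  rw [show fderiv ℝ ρ p (x - y) = inner ℝ (gradient ρ p) (x - y) by simp [gradient]] at h1
  rw [Subtype.dist_eq, dist_eq_norm, dist_eq_norm]
  simp only [domRestrict_apply]
  rw [← map_sub]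
  set g := gradient ρ p
  set u := x - y
  have hpy := Submodule.norm_sq_eq_add_norm_sq_projection u (Submodule.span ℝ {g})
  have hpr : ‖(Submodule.span ℝ {g}).orthogonalProjectionOnto u‖ * ‖g‖ = ‖(inner ℝ g u : ℝ)‖ := by
    rw [Submodule.coe_norm, Submodule.coe_orthogonalProjectionOnto_apply,
      Submodule.starProjection_singleton, norm_smul, norm_div]
    simp
    field_simp
  have h2 : ‖(Submodule.span ℝ {g}).orthogonalProjectionOnto u‖ ≤ ‖u‖ / 2 := by
    refine le_of_mul_le_mul_right ?_ hg
    rw [hpr]; linarith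
  have := norm_nonneg ((Submodule.span ℝ {g}).orthogonalProjectionOnto u)
  refine le_of_sq_le_sq ?_ (by positivity)
  push_cast
  nlinarith

/-- The antilipschitz projection compares a boundary patch with a bounded subset of a hyperplane of
dimension D - 1, where Hausdorff measure is finite on bounded sets. -/
lemma exists_surface_lt_top (h : IsLocalDefiningFunction Ω p ρ) (hΩ : IsOpen Ω)
    (hb : Bornology.IsBounded Ω) :
    ∃ V ∈ 𝓝 p, Measure.euclideanHausdorffMeasure (D - 1) (frontier Ω ∩ V) < ⊤ := by
  obtain ⟨V, hV, hanti⟩ := h.exists_antilipschitz hΩ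
  refine ⟨V, hV, ?_⟩
  set S := (Submodule.span ℝ {gradient ρ p})ᗮ
  set T := frontier Ω ∩ V
  have hdim : Module.finrank ℝ S = D - 1 := by
    have h1 := Submodule.finrank_add_finrank_orthogonal (Submodule.span ℝ {gradient ρ p})
    rw [finrank_span_singleton h.1, finrank_euclideanSpace, Fintype.card_fin] at h1
    change 1 + Module.finrank ℝ S = D at h1
    omega
  have hT : Bornology.IsBounded T := (hb.closure.subset frontier_subset_closure).subset
    inter_subset_left
  have hle := hanti.le_hausdorffMeasure_image (d := ((D - 1 : ℕ) : ℝ)) (by positivity) univ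
  have hS : Measure.hausdorffMeasure ((D - 1 : ℕ) : ℝ)
      (T.domRestrict S.orthogonalProjectionOnto '' univ) < ⊤ := by
    rw [← hdim]
    refine Bornology.IsBounded.measure_lt_top ?_
    rw [image_univ, range_domRestrict]
    exact S.orthogonalProjectionOnto.lipschitz.isBounded_image hT
  have hT' : Measure.hausdorffMeasure ((D - 1 : ℕ) : ℝ) T < ⊤ := by
    have himg := (isometry_subtype_coe (s := T)).hausdorffMeasure_image
      (d := ((D - 1 : ℕ) : ℝ)) (Or.inl (by positivity)) univ
    rw [image_univ, Subtype.range_coe] at himg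
    rw [himg]
    refine hle.trans_lt (ENNReal.mul_lt_top ?_ hS)
    exact ENNReal.rpow_lt_top_of_nonneg (by positivity) ENNReal.coe_ne_top
  rw [Measure.euclideanHausdorffMeasure_def, Measure.smul_apply]
  exact ENNReal.mul_lt_top ENNReal.coe_lt_top hT'

end IsLocalDefiningFunction

namespace IsSmoothBoundedDomain

variable {D : ℕ} {Ω : Set (Space D)}

lemma isCompact_frontier (hΩ : IsSmoothBoundedDomain Ω) : IsCompact (frontier Ω) :=
  Metric.isCompact_of_isClosed_isBounded isClosed_frontier
    (hΩ.isBounded.closure.subset frontier_subset_closure)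

lemma norm_outwardNormal (hΩ : IsSmoothBoundedDomain Ω) {x : Space D} (hx : x ∈ frontier Ω) :
    ‖outwardNormal Ω x‖ = 1 := by
  obtain ⟨ρ, hρ⟩ := hΩ.smooth_boundary x hx
  rw [hρ.outwardNormal_eq hΩ.isOpen hx]
  simpa using norm_smul_inv_norm (𝕜 := ℝ) hρ.1

lemma continuousOn_outwardNormal (hΩ : IsSmoothBoundedDomain Ω) :
    ContinuousOn (outwardNormal Ω) (frontier Ω) := by
  intro p hp
  obtain ⟨ρ, hρ⟩ := hΩ.smooth_boundary p hp
  have hc : ContinuousAt (gradient ρ) p := hρ.eventually.self_of_nhds.2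
  have hc' : ContinuousAt (fun x => ‖gradient ρ x‖⁻¹ • gradient ρ x) p :=
    (hc.norm.inv₀ (norm_ne_zero_iff.2 hρ.1)).smul hc
  refine hc'.continuousWithinAt.congr_of_eventuallyEq ?_ (hρ.outwardNormal_eq hΩ.isOpen hp)
  filter_upwards [mem_nhdsWithin_of_mem_nhds hρ.eventually, self_mem_nhdsWithin] with x hx hxf
  exact hx.1.outwardNormal_eq hΩ.isOpen hxf

lemma isFiniteMeasure_surfaceMeasure (hΩ : IsSmoothBoundedDomain Ω) :
    IsFiniteMeasure (surfaceMeasure Ω) := by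
  refine isFiniteMeasure_restrict.2 (ne_of_lt ?_)
  refine hΩ.isCompact_frontier.measure_lt_top_of_nhdsWithin fun p hp => ?_
  obtain ⟨ρ, hρ⟩ := hΩ.smooth_boundary p hp
  obtain ⟨V, hV, hfin⟩ := hρ.exists_surface_lt_top hΩ.isOpen hΩ.isBounded
  exact ⟨frontier Ω ∩ V, inter_mem self_mem_nhdsWithin (mem_nhdsWithin_of_mem_nhds hV), hfin⟩

lemma ae_mem_frontier : ∀ᵐ x ∂(surfaceMeasure Ω), x ∈ frontier Ω :=
  ae_restrict_mem isClosed_frontier.measurableSet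

end IsSmoothBoundedDomain

end AcousticLimit

/-! ### Estimate at a fixed boundary point and time. -/

namespace AcousticLimit

lemma eta_eq_relEta_one (Z : ℝ) : eta Z = relEta 1 Z := by simp [eta, relEta]

/-- Bregman form of the density: the term linear in Z - A averages out, leaving the bracket of the
Darrozès–Guiraud information. -/
lemma relEta_eq_eta_sub (A Z : ℝ) :
    relEta A Z = eta Z - eta A - Real.log A * (Z - A) := by
  unfold relEta eta; ring

lemma measurable_eta : Measurable eta := by
  unfold eta; fun_prop

/-- The outgoing velocities at the boundary point `x`. -/
def outgoing {D : ℕ} (Ω : Set (Space D)) (x : Space D) : Set (Space D) :=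
  {v | 0 < inner ℝ v (outwardNormal Ω x)}

section Fibre

variable {D : ℕ} {Ω : Set (Space D)} {x : Space D} {X : Space D → ℝ} {α : ℝ}

lemma measurableSet_outgoing : MeasurableSet (outgoing Ω x) :=
  measurableSet_lt (by fun_prop) (by fun_prop)

lemma inner_reflect (hn : ‖outwardNormal Ω x‖ = 1) (v : Space D) :
    inner ℝ (reflect Ω x v) (outwardNormal Ω x) = -inner ℝ v (outwardNormal Ω x) := by
  rw [reflect, inner_sub_left, real_inner_smul_left, real_inner_self_eq_norm_sq, hn]
  ring

lemma measurePreserving_reflect (hn : ‖outwardNormal Ω x‖ = 1) :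
    MeasurePreserving (reflect Ω x) (maxw D) (maxw D) :=
  measurePreserving_reflection_maxw hn

lemma aestronglyMeasurable_mul_inner (hX : AEStronglyMeasurable X (maxw D)) :
    AEStronglyMeasurable (fun v => X v * inner ℝ v (outwardNormal Ω x)) (maxw D) :=
  hX.mul (by fun_prop)

lemma integrable_renorm_mul_inner (hX : AEStronglyMeasurable X (maxw D)) :
    Integrable (fun v => renorm (X v) * inner ℝ v (outwardNormal Ω x)) (maxw D) := by
  refine (integrable_inner_maxw (outwardNormal Ω x)).bdd_mul (c := 1)
    (measurable_renorm.comp_aemeasurable hX.aemeasurable).aestronglyMeasurable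
    (.of_forall fun v => renorm_abs_le _)

lemma integrable_defect_mul_inner (hX : AEStronglyMeasurable X (maxw D)) (α A : ℝ) :
    Integrable (fun v => (renorm (X v) - renorm ((1 - α) * X v + α * A))
      * inner ℝ v (outwardNormal Ω x)) (maxw D) := by
  have h1 := integrable_renorm_mul_inner (Ω := Ω) (x := x) hX
  have h2 := integrable_renorm_mul_inner (Ω := Ω) (x := x) (X := fun v => (1 - α) * X v + α * A)
    ((hX.const_mul _).add aestronglyMeasurable_const)
  refine (h1.sub h2).congr (.of_forall fun v => ?_)
  simp only [Pi.sub_apply, sub_mul]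

lemma integrableOn_mul_inner_of_diffuse_ne_top (hX : AEStronglyMeasurable X (maxw D))
    (h0 : ∀ᵐ v ∂(maxw D), 0 ≤ X v) (hfin : diffuse Ω x X ≠ ⊤) :
    IntegrableOn (fun v => X v * inner ℝ v (outwardNormal Ω x)) (outgoing Ω x) (maxw D) ∧
      (diffuse Ω x X).toReal = Real.sqrt (2 * Real.pi) *
        ∫ v in outgoing Ω x, X v * inner ℝ v (outwardNormal Ω x) ∂(maxw D) := by
  have hnn : ∀ᵐ v ∂((maxw D).restrict (outgoing Ω x)),
      0 ≤ X v * inner ℝ v (outwardNormal Ω x) := by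
    filter_upwards [ae_restrict_of_ae h0, ae_restrict_mem measurableSet_outgoing] with v hv hv'
    exact mul_nonneg hv (le_of_lt hv')
  have hm := (aestronglyMeasurable_mul_inner (Ω := Ω) (x := x) hX).restrict (s := outgoing Ω x)
  have heq : diffuse Ω x X = ENNReal.ofReal (Real.sqrt (2 * Real.pi)) *
      ∫⁻ v in outgoing Ω x, ENNReal.ofReal (X v * inner ℝ v (outwardNormal Ω x)) ∂(maxw D) := by
    rw [diffuse]
    congr 1
    refine lintegral_congr_ae ?_
    filter_upwards [ae_restrict_of_ae h0] with v hv
    rw [ENNReal.ofReal_mul hv]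
  have hc : ENNReal.ofReal (Real.sqrt (2 * Real.pi)) ≠ 0 := by
    rw [Ne, ENNReal.ofReal_eq_zero, not_le]; positivity
  refine ⟨⟨hm, ?_⟩, ?_⟩
  · rw [hasFiniteIntegral_iff_ofReal hnn]
    rw [heq] at hfin
    exact (ENNReal.lt_top_of_mul_ne_top_right hfin hc)
  · rw [heq, ENNReal.toReal_mul, ENNReal.toReal_ofReal (Real.sqrt_nonneg _),
      integral_eq_lintegral_of_nonneg_ae hnn hm]

lemma integral_inner_outgoing (hn : ‖outwardNormal Ω x‖ = 1) :
    Real.sqrt (2 * Real.pi) * ∫ v in outgoing Ω x, inner ℝ v (outwardNormal Ω x) ∂(maxw D) = 1 := by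
  rw [outgoing, integral_inner_halfspace_maxw hn, mul_inv_cancel₀ (by positivity)]

/-- The mass flux of `renorm ∘ X` through the boundary, written on the outgoing velocities by means
of the Maxwell reflection law. -/
lemma integral_renorm_mul_inner_eq (hn : ‖outwardNormal Ω x‖ = 1)
    (hX : AEStronglyMeasurable X (maxw D)) (h0 : ∀ᵐ v ∂(maxw D), 0 ≤ X v)
    (hα : α ∈ Icc (0 : ℝ) 1) (hfin : α = 0 ∨ diffuse Ω x X ≠ ⊤)
    (hbc : ∀ᵐ v ∂(maxw D), inner ℝ v (outwardNormal Ω x) < 0 →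
      ENNReal.ofReal (X v) = ENNReal.ofReal (1 - α) * ENNReal.ofReal (X (reflect Ω x v))
        + ENNReal.ofReal α * diffuse Ω x X) :
    ∫ v, renorm (X v) * inner ℝ v (outwardNormal Ω x) ∂(maxw D) =
      ∫ v in outgoing Ω x, (renorm (X v) - renorm ((1 - α) * X v + α * (diffuse Ω x X).toReal))
        * inner ℝ v (outwardNormal Ω x) ∂(maxw D) := by
  set A := (diffuse Ω x X).toReal with hA
  have hA0 : 0 ≤ A := ENNReal.toReal_nonneg
  -- For α = 0 the diffuse flux may be infinite; both sides still vanish since 0 · ∞ = 0 in `ℝ≥0∞`.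
  have hαA : ENNReal.ofReal α * diffuse Ω x X = ENNReal.ofReal (α * A) := by
    rcases hfin with rfl | hfin
    · simp
    · rw [ENNReal.ofReal_mul hα.1, hA, ENNReal.ofReal_toReal hfin]
  have hR := measurePreserving_reflect hn
  set K : Space D → ℝ := fun v => renorm ((1 - α) * X v + α * A) * inner ℝ v (outwardNormal Ω x)
    with hK
  have hF := integrable_renorm_mul_inner (Ω := Ω) (x := x) hX
  have hKi : Integrable K (maxw D) :=
    integrable_renorm_mul_inner (X := fun v => (1 - α) * X v + α * A)
      ((hX.const_mul _).add aestronglyMeasurable_const)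
  -- Change variables by the reflection, which preserves `M dv` and flips the sign of v·n. Grazing
  -- velocities contribute nothing.
  have h1 : ∫ v in (outgoing Ω x)ᶜ, renorm (X v) * inner ℝ v (outwardNormal Ω x) ∂(maxw D)
      = - ∫ v in outgoing Ω x, K v ∂(maxw D) := by
    rw [← integral_indicator measurableSet_outgoing.compl,
      ← integral_indicator measurableSet_outgoing, ← integral_neg]
    have h2 := integral_map (φ := reflect Ω x) (μ := maxw D)
      (f := fun v => -(outgoing Ω x).indicator K v) hR.measurable.aemeasurable (by
        rw [hR.map_eq]
        exact (hKi.1.indicator measurableSet_outgoing).neg)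
    rw [hR.map_eq] at h2
    rw [h2]
    refine integral_congr_ae ?_
    filter_upwards [hbc, h0, hR.quasiMeasurePreserving.ae h0] with v hv hv0 hv1
    have hin := inner_reflect hn v
    rcases lt_trichotomy (inner ℝ v (outwardNormal Ω x)) 0 with hneg | hz | hpos
    · have m1 : v ∈ (outgoing Ω x)ᶜ := not_lt.2 hneg.le
      have m2 : reflect Ω x v ∈ outgoing Ω x := by
        change 0 < inner ℝ _ _
        rw [hin]; linarith
      rw [indicator_of_mem m1, indicator_of_mem m2, hK]
      simp only
      rw [hin, mul_neg, neg_neg]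
      have h3 := hv hneg
      have h4 := mul_nonneg (sub_nonneg.2 hα.2) hv1
      have h5 := mul_nonneg hα.1 hA0
      rw [hαA, ← ENNReal.ofReal_mul (sub_nonneg.2 hα.2), ← ENNReal.ofReal_add h4 h5,
        ENNReal.ofReal_eq_ofReal_iff hv0 (add_nonneg h4 h5)] at h3
      rw [h3]
    · have m1 : v ∈ (outgoing Ω x)ᶜ := not_lt.2 hz.le
      have m2 : reflect Ω x v ∉ outgoing Ω x := by
        change ¬ 0 < inner ℝ _ _
        rw [hin, hz]; simp
      rw [indicator_of_mem m1, indicator_of_notMem m2, hz, mul_zero, neg_zero]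
    · have m1 : v ∉ (outgoing Ω x)ᶜ := not_not.2 hpos
      have m2 : reflect Ω x v ∉ outgoing Ω x := by
        change ¬ 0 < inner ℝ _ _
        rw [hin]; linarith
      rw [indicator_of_notMem m1, indicator_of_notMem m2, neg_zero]
  rw [← integral_add_compl measurableSet_outgoing hF, h1, ← sub_eq_add_neg,
    ← integral_sub hF.integrableOn hKi.integrableOn]
  refine integral_congr_ae (.of_forall fun v => ?_)
  simp only [hK]
  ring

/-- The trace takes real values, whereas an infinite diffuse term with α > 0 would force it to be
infinite at almost every incoming velocity. -/
lemma diffuse_ne_top (hn : ‖outwardNormal Ω x‖ = 1) (hα : 0 < α)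
    (hbc : ∀ᵐ v ∂(maxw D), inner ℝ v (outwardNormal Ω x) < 0 →
      ENNReal.ofReal (X v) = ENNReal.ofReal (1 - α) * ENNReal.ofReal (X (reflect Ω x v))
        + ENNReal.ofReal α * diffuse Ω x X) : diffuse Ω x X ≠ ⊤ := by
  intro htop
  refine maxw_incoming_ne_zero hn (measure_mono_null (fun v hv => ?_) (ae_iff.1 hbc))
  intro h
  have h1 := h hv
  rw [htop, ENNReal.mul_top (by simpa using hα), add_top] at h1
  exact ENNReal.ofReal_ne_top h1

/-- The diffuse average is the mean of X for a probability measure; this cancellation removes every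
first-order term. -/
lemma integral_sub_mul_inner_outgoing (hn : ‖outwardNormal Ω x‖ = 1)
    (hX : AEStronglyMeasurable X (maxw D)) (h0 : ∀ᵐ v ∂(maxw D), 0 ≤ X v)
    (hfin : diffuse Ω x X ≠ ⊤) :
    IntegrableOn (fun v => X v * inner ℝ v (outwardNormal Ω x)
      - (diffuse Ω x X).toReal * inner ℝ v (outwardNormal Ω x)) (outgoing Ω x) (maxw D) ∧
    ∫ v in outgoing Ω x, (X v * inner ℝ v (outwardNormal Ω x)
        - (diffuse Ω x X).toReal * inner ℝ v (outwardNormal Ω x)) ∂(maxw D) = 0 := by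
  obtain ⟨hXi, hXe⟩ := integrableOn_mul_inner_of_diffuse_ne_top hX h0 hfin
  have hni : IntegrableOn (fun v => (diffuse Ω x X).toReal * inner ℝ v (outwardNormal Ω x))
    (outgoing Ω x) (maxw D) := ((integrable_inner_maxw _).const_mul _).integrableOn
  refine ⟨hXi.sub hni, ?_⟩
  rw [integral_sub hXi hni, integral_const_mul]
  have : Real.sqrt (2 * Real.pi) ≠ 0 := by positivity
  refine (mul_eq_zero.1 (?_ : Real.sqrt (2 * Real.pi) * _ = 0)).resolve_left this
  rw [mul_sub, ← hXe, mul_left_comm, integral_inner_outgoing hn]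
  ring

/-- The Darrozès–Guiraud bracket is the integral of a relative entropy density. -/
lemma integral_relEta_mul_inner (hn : ‖outwardNormal Ω x‖ = 1)
    (hX : AEStronglyMeasurable X (maxw D)) (h0 : ∀ᵐ v ∂(maxw D), 0 ≤ X v)
    (hfin : diffuse Ω x X ≠ ⊤) (hfin' : diffuse Ω x (fun v => eta (X v)) ≠ ⊤) :
    IntegrableOn (fun v => relEta (diffuse Ω x X).toReal (X v) * inner ℝ v (outwardNormal Ω x))
      (outgoing Ω x) (maxw D) ∧
    Real.sqrt (2 * Real.pi) * ∫ v in outgoing Ω x,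
      relEta (diffuse Ω x X).toReal (X v) * inner ℝ v (outwardNormal Ω x) ∂(maxw D)
      = (diffuse Ω x (fun v => eta (X v))).toReal - eta (diffuse Ω x X).toReal := by
  obtain ⟨hdi, hd0⟩ := integral_sub_mul_inner_outgoing hn hX h0 hfin
  obtain ⟨hEi, hEe⟩ := integrableOn_mul_inner_of_diffuse_ne_top (Ω := Ω) (x := x)
    (X := fun v => eta (X v))
    (measurable_eta.comp_aemeasurable hX.aemeasurable).aestronglyMeasurable
    (h0.mono fun v hv => (eta_eq_relEta_one _).symm ▸ relEta_nonneg one_pos hv) hfin'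
  rw [hEe]
  generalize (diffuse Ω x X).toReal = A at *
  have hni : IntegrableOn (fun v => eta A * inner ℝ v (outwardNormal Ω x))
    (outgoing Ω x) (maxw D) := ((integrable_inner_maxw _).const_mul _).integrableOn
  have hei : IntegrableOn (fun v => eta (X v) * inner ℝ v (outwardNormal Ω x)
    - eta A * inner ℝ v (outwardNormal Ω x)) (outgoing Ω x) (maxw D) := hEi.sub hni
  have hrel : ∀ v, relEta A (X v) * inner ℝ v (outwardNormal Ω x)
      = eta (X v) * inner ℝ v (outwardNormal Ω x)
        - eta A * inner ℝ v (outwardNormal Ω x)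
        - Real.log A * (X v * inner ℝ v (outwardNormal Ω x)
          - A * inner ℝ v (outwardNormal Ω x)) := by
    intro v; rw [relEta_eq_eta_sub]; ring
  simp_rw [hrel]
  refine ⟨hei.sub (hdi.const_mul _), ?_⟩
  rw [integral_sub hei (hdi.const_mul _), integral_const_mul (Real.log A), hd0,
    integral_sub hEi hni, integral_const_mul (eta A), mul_zero, sub_zero, mul_sub,
    mul_left_comm, integral_inner_outgoing hn, mul_one]

/-- The mass flux of `renorm ∘ X` through the boundary is controlled by the Darrozès–Guiraud
information. -/
lemma enorm_integral_renorm_mul_inner_le (hn : ‖outwardNormal Ω x‖ = 1)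
    (hX : AEStronglyMeasurable X (maxw D)) (h0 : ∀ᵐ v ∂(maxw D), 0 ≤ X v)
    (hα : α ∈ Icc (0 : ℝ) 1) (hα0 : 0 < α)
    (hbc : ∀ᵐ v ∂(maxw D), inner ℝ v (outwardNormal Ω x) < 0 →
      ENNReal.ofReal (X v) = ENNReal.ofReal (1 - α) * ENNReal.ofReal (X (reflect Ω x v))
        + ENNReal.ofReal α * diffuse Ω x X) :
    ‖∫ v, renorm (X v) * inner ℝ v (outwardNormal Ω x) ∂(maxw D)‖ₑ ≤
      16 * (diffuse Ω x (fun v => eta (X v))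
        - ENNReal.ofReal (eta (diffuse Ω x X).toReal)) := by
  have hfin := diffuse_ne_top hn hα0 hbc
  rw [integral_renorm_mul_inner_eq hn hX h0 hα (Or.inr hfin) hbc]
  obtain ⟨hXi, hXe⟩ := integrableOn_mul_inner_of_diffuse_ne_top hX h0 hfin
  set A := (diffuse Ω x X).toReal with hA
  have hA0 : 0 ≤ A := ENNReal.toReal_nonneg
  by_cases htop : diffuse Ω x (fun v => eta (X v)) = ⊤
  · rw [htop, ENNReal.top_sub ENNReal.ofReal_ne_top, ENNReal.mul_top (by norm_num)]
    exact le_top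
  have hc : 1 ≤ Real.sqrt (2 * Real.pi) := by
    rw [Real.one_le_sqrt]
    linarith [Real.pi_gt_three]
  have hnonneg : ∀ᵐ v ∂((maxw D).restrict (outgoing Ω x)),
      0 ≤ X v ∧ 0 < inner ℝ v (outwardNormal Ω x) := by
    filter_upwards [ae_restrict_of_ae h0, ae_restrict_mem measurableSet_outgoing] with v h1 h2
    exact ⟨h1, h2⟩
  -- The entropy density involves log A, so A = 0 is treated apart: then X vanishes at almost every
  -- outgoing velocity, and so does the defect.
  rcases hA0.eq_or_lt with hAz | hApos
  · rw [← hAz] at hXe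
    have hz : ∫ v in outgoing Ω x, X v * inner ℝ v (outwardNormal Ω x) ∂(maxw D) = 0 := by
      rcases mul_eq_zero.1 hXe.symm with h | h
      · linarith
      · exact h
    rw [setIntegral_eq_zero_iff_of_nonneg_ae
      (hnonneg.mono fun v hv => mul_nonneg hv.1 hv.2.le) hXi] at hz
    have : ∀ᵐ v ∂((maxw D).restrict (outgoing Ω x)),
        (renorm (X v) - renorm ((1 - α) * X v + α * A)) * inner ℝ v (outwardNormal Ω x) = 0 := by
      filter_upwards [hz, hnonneg] with v h1 h2
      have : X v = 0 := (mul_eq_zero.1 h1).resolve_right h2.2.ne'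
      rw [this, ← hAz]
      simp
    rw [integral_eq_zero_of_ae this]
    simp
  · obtain ⟨hri, hre⟩ := integral_relEta_mul_inner hn hX h0 hfin htop
    obtain ⟨hdi, hd0⟩ := integral_sub_mul_inner_outgoing hn hX h0 hfin
    rw [← hA] at hri hre hdi hd0
    set E := (diffuse Ω x (fun v => eta (X v))).toReal with hE
    have hr0 : 0 ≤ ∫ v in outgoing Ω x,
        relEta A (X v) * inner ℝ v (outwardNormal Ω x) ∂(maxw D) :=
      integral_nonneg_of_ae (hnonneg.mono fun v hv => mul_nonneg (relEta_nonneg hApos hv.1) hv.2.le)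
    have hmain : ‖∫ v in outgoing Ω x, (renorm (X v) - renorm ((1 - α) * X v + α * A))
        * inner ℝ v (outwardNormal Ω x) ∂(maxw D)‖ ≤ 16 * (E - eta A) := by
      -- Subtracting the zero-mean linear term turns the integrand into a pure second-order
      -- remainder.
      have hsub : ∫ v in outgoing Ω x, (renorm (X v) - renorm ((1 - α) * X v + α * A))
          * inner ℝ v (outwardNormal Ω x) ∂(maxw D)
          = ∫ v in outgoing Ω x, ((renorm (X v) - renorm ((1 - α) * X v + α * A))
            * inner ℝ v (outwardNormal Ω x) - α * renormDeriv A *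
              (X v * inner ℝ v (outwardNormal Ω x)
                - A * inner ℝ v (outwardNormal Ω x))) ∂(maxw D) := by
        rw [integral_sub (integrable_defect_mul_inner hX α A).integrableOn (hdi.const_mul _),
          integral_const_mul, hd0, mul_zero, sub_zero]
      rw [hsub]
      calc _ ≤ ∫ v in outgoing Ω x, 16 * (relEta A (X v) * inner ℝ v (outwardNormal Ω x))
              ∂(maxw D) := by
            refine norm_integral_le_of_norm_le (hri.const_mul 16) ?_
            filter_upwards [hnonneg] with v hv
            have h := abs_renorm_reflection_defect_le hApos hv.1 hα.1 hα.2
            have h' := mul_le_mul_of_nonneg_right h hv.2.le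
            rw [← abs_of_pos hv.2, ← abs_mul, abs_of_pos hv.2] at h'
            rw [Real.norm_eq_abs]
            convert! h' using 1
            · congr 1; ring
            · ring
        _ = 16 * ∫ v in outgoing Ω x, relEta A (X v) * inner ℝ v (outwardNormal Ω x)
              ∂(maxw D) := integral_const_mul _ _
        _ ≤ 16 * (E - eta A) := by
            rw [← hre]
            gcongr
            exact le_mul_of_one_le_left hr0 hc
    have heA : 0 ≤ eta A := (eta_eq_relEta_one A).symm ▸ relEta_nonneg one_pos hA0
    rw [← ofReal_norm, ← ENNReal.ofReal_toReal htop, ← hE, ← ENNReal.ofReal_sub _ heA,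
      show (16 : ℝ≥0∞) = ENNReal.ofReal 16 by norm_num, ← ENNReal.ofReal_mul (by norm_num)]
    exact ENNReal.ofReal_le_ofReal hmain

lemma integral_renorm_mul_inner_eq_zero_of_specular (hn : ‖outwardNormal Ω x‖ = 1)
    (hX : AEStronglyMeasurable X (maxw D)) (h0 : ∀ᵐ v ∂(maxw D), 0 ≤ X v)
    (hbc : ∀ᵐ v ∂(maxw D), inner ℝ v (outwardNormal Ω x) < 0 →
      ENNReal.ofReal (X v) = ENNReal.ofReal (1 - 0) * ENNReal.ofReal (X (reflect Ω x v))
        + ENNReal.ofReal 0 * diffuse Ω x X) :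
    ∫ v, renorm (X v) * inner ℝ v (outwardNormal Ω x) ∂(maxw D) = 0 := by
  rw [integral_renorm_mul_inner_eq hn hX h0 (by simp) (Or.inl rfl) hbc]
  simp

lemma inner_integral_renorm_smul (hX : AEStronglyMeasurable X (maxw D)) (d : ℝ) :
    inner ℝ (∫ v, (renorm (X v) / d) • v ∂(maxw D)) (outwardNormal Ω x)
      = d⁻¹ * ∫ v, renorm (X v) * inner ℝ v (outwardNormal Ω x) ∂(maxw D) := by
  have hm : AEStronglyMeasurable (fun v => (renorm (X v) / d) • v) (maxw D) :=
    ((measurable_renorm.comp_aemeasurable hX.aemeasurable).div_const d).aestronglyMeasurable.smul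
      aestronglyMeasurable_id
  have hi : Integrable (fun v => (renorm (X v) / d) • v) (maxw D) := by
    refine ((integrable_norm_maxw D).const_mul |d|⁻¹).mono' hm (.of_forall fun v => ?_)
    rw [norm_smul, Real.norm_eq_abs, abs_div, div_eq_inv_mul]
    gcongr
    exact mul_le_of_le_one_right (by positivity) (renorm_abs_le _)
  rw [real_inner_comm, ← integral_inner hi, ← integral_const_mul]
  refine integral_congr_ae (.of_forall fun v => ?_)
  simp only [real_inner_smul_right, real_inner_comm (outwardNormal Ω x) v]
  ring

end Fibre

end AcousticLimit

/-! ### Integration over the boundary and time, and use of the entropy inequality. -/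

namespace AcousticLimit

section Flux

variable {D : ℕ} {Ω : Set (Space D)} {b : Sph D → Space D → ℝ} {α ε : ℝ}
  {Gin : Space D × Space D → ℝ} {G γG : ℝ → Space D × Space D → ℝ} {χ : Space D → ℝ}

/-- The properties of the trace at almost every boundary point and time. -/
lemma IsRenormalizedSolution.ae_trace (hΩ : IsSmoothBoundedDomain Ω)
    (hG : IsRenormalizedSolution Ω b α ε Gin G γG) :
    ∀ᵐ t ∂(volume.restrict (Ioi (0 : ℝ))), ∀ᵐ x ∂(surfaceMeasure Ω),
      x ∈ frontier Ω ∧ AEStronglyMeasurable (fun v => γG t (v, x)) (maxw D) ∧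
      (∀ᵐ v ∂(maxw D), 0 ≤ γG t (v, x)) ∧
      ∀ᵐ v ∂(maxw D), inner ℝ v (outwardNormal Ω x) < 0 →
        ENNReal.ofReal (γG t (v, x))
          = ENNReal.ofReal (1 - α) * ENNReal.ofReal (γG t (reflect Ω x v, x))
            + ENNReal.ofReal α * diffuse Ω x (fun v => γG t (v, x)) := by
  have := hΩ.isFiniteMeasure_surfaceMeasure
  have h1 := hG.trace_measurable
  have h2 := Measure.ae_ae_of_ae_prod hG.trace_nonneg
  have h3 := Measure.ae_ae_of_ae_prod hG.boundary_condition
  filter_upwards [h1.prodMk_left, h2, h3] with t ht1 ht2 ht3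
  filter_upwards [ht1.prodMk_left, Measure.ae_ae_of_ae_prod ht2, Measure.ae_ae_of_ae_prod ht3,
    IsSmoothBoundedDomain.ae_mem_frontier] with x hx1 hx2 hx3 hx4
  exact ⟨hx4, hx1, hx2, hx3⟩

lemma exists_abs_le_on_frontier (hΩ : IsSmoothBoundedDomain Ω)
    (hχ : ContinuousOn χ (closure Ω)) : ∃ K, 0 ≤ K ∧ ∀ x ∈ frontier Ω, |χ x| ≤ K := by
  obtain ⟨K, hK⟩ := hΩ.isCompact_frontier.exists_bound_of_continuousOn
    (hχ.mono frontier_subset_closure)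
  exact ⟨max K 0, le_max_right _ _, fun x hx => (hK x hx).trans (le_max_left _ _)⟩

/-- Since |`renorm`| ≤ 1 and the normal is a unit vector, a constant multiple of |v| dominates the
integrand and is integrable for the finite surface measure on a bounded time interval. -/
lemma IsRenormalizedSolution.integrable_boundary_flux (hΩ : IsSmoothBoundedDomain Ω)
    (hG : IsRenormalizedSolution Ω b α ε Gin G γG) (hχ : ContinuousOn χ (closure Ω)) (d : ℝ)
    {t₁ t₂ : ℝ} (ht₁ : 0 ≤ t₁) :
    Integrable (fun p : ℝ × Space D × Space D => χ p.2.1 *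
      (renorm (γG p.1 (p.2.2, p.2.1)) / d * inner ℝ p.2.2 (outwardNormal Ω p.2.1)))
      (boundaryTime Ω (Ioc t₁ t₂)) := by
  have := hΩ.isFiniteMeasure_surfaceMeasure
  obtain ⟨K, hK0, hK⟩ := exists_abs_le_on_frontier hΩ hχ
  have hac : boundaryTime Ω (Ioc t₁ t₂) ≪ boundaryTime Ω (Ioi 0) :=
    (Measure.restrict_mono (fun t ht => ht₁.trans_lt ht.1) le_rfl).absolutelyContinuous.prod
      Measure.AbsolutelyContinuous.rfl
  have hfr : MeasurableSet (frontier Ω) := isClosed_frontier.measurableSet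
  have hχm : AEStronglyMeasurable χ (surfaceMeasure Ω) :=
    (hχ.mono frontier_subset_closure).aestronglyMeasurable hfr
  have hnm : AEStronglyMeasurable (outwardNormal Ω) (surfaceMeasure Ω) :=
    hΩ.continuousOn_outwardNormal.aestronglyMeasurable hfr
  have hχm' : AEStronglyMeasurable (fun p : ℝ × Space D × Space D => χ p.2.1)
      (boundaryTime Ω (Ioc t₁ t₂)) := hχm.comp_fst.comp_snd
  have hnm' : AEStronglyMeasurable (fun p : ℝ × Space D × Space D => outwardNormal Ω p.2.1)
      (boundaryTime Ω (Ioc t₁ t₂)) := hnm.comp_fst.comp_snd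
  have hγm := (hG.trace_measurable.mono_ac hac).aemeasurable
  have hfront : ∀ᵐ p ∂(boundaryTime Ω (Ioc t₁ t₂)), p.2.1 ∈ frontier Ω :=
    Measure.quasiMeasurePreserving_snd.ae
      (Measure.quasiMeasurePreserving_fst.ae IsSmoothBoundedDomain.ae_mem_frontier)
  have hv : Integrable (fun p : ℝ × Space D × Space D => ‖p.2.2‖)
      (boundaryTime Ω (Ioc t₁ t₂)) :=
    ((integrable_norm_maxw D).comp_snd (surfaceMeasure Ω)).comp_snd _
  refine (hv.const_mul (K * |d|⁻¹)).mono' (hχm'.mul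
    (((measurable_renorm.comp_aemeasurable hγm).div_const d).aestronglyMeasurable.mul
      (measurable_snd.snd.aestronglyMeasurable.inner hnm'))) ?_
  filter_upwards [hfront] with p hp
  rw [norm_mul, norm_mul, Real.norm_eq_abs, Real.norm_eq_abs, abs_div, mul_assoc]
  have h1 : ‖inner ℝ p.2.2 (outwardNormal Ω p.2.1)‖ ≤ ‖p.2.2‖ := by
    simpa [hΩ.norm_outwardNormal hp] using norm_inner_le_norm (𝕜 := ℝ) p.2.2 (outwardNormal Ω p.2.1)
  have h2 : |renorm (γG p.1 (p.2.2, p.2.1))| / |d| ≤ |d|⁻¹ := by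
    rw [div_eq_mul_inv]
    exact mul_le_of_le_one_left (by positivity) (renorm_abs_le _)
  gcongr
  exact hK _ hp

lemma enorm_boundaryMassFlux_le {t₁ t₂ : ℝ} (ht : t₁ ≤ t₂) (d : ℝ) :
    ‖boundaryMassFlux Ω d γG χ t₁ t₂‖ₑ ≤ ∫⁻ t in Ioc t₁ t₂, ∫⁻ x,
      ‖χ x * inner ℝ (∫ v, (renorm (γG t (v, x)) / d) • v ∂(maxw D)) (outwardNormal Ω x)‖ₑ
        ∂(surfaceMeasure Ω) := by
  rw [boundaryMassFlux, intervalIntegral.integral_of_le ht]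
  exact (enorm_integral_le_lintegral_enorm _).trans
    (lintegral_mono fun t => enorm_integral_le_lintegral_enorm _)

lemma IsRenormalizedSolution.boundaryMassFlux_eq_zero_of_specular (hΩ : IsSmoothBoundedDomain Ω)
    (hG : IsRenormalizedSolution Ω b 0 ε Gin G γG) (d : ℝ) {t₁ t₂ : ℝ} (ht₁ : 0 ≤ t₁)
    (ht : t₁ ≤ t₂) : boundaryMassFlux Ω d γG χ t₁ t₂ = 0 := by
  have hsub : Ioc t₁ t₂ ⊆ Ioi 0 := fun t h => ht₁.trans_lt h.1
  rw [← enorm_eq_zero, ← nonpos_iff_eq_zero]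
  refine (enorm_boundaryMassFlux_le ht d).trans_eq ?_
  have h0 : ∀ᵐ t ∂(volume.restrict (Ioc t₁ t₂)), ∫⁻ x,
      ‖χ x * inner ℝ (∫ v, (renorm (γG t (v, x)) / d) • v ∂(maxw D)) (outwardNormal Ω x)‖ₑ
        ∂(surfaceMeasure Ω) = 0 := by
    filter_upwards [ae_restrict_of_ae_restrict_of_subset hsub (hG.ae_trace hΩ)] with t ht
    rw [← lintegral_zero (μ := surfaceMeasure Ω)]
    refine lintegral_congr_ae ?_
    filter_upwards [ht] with x hx
    rw [inner_integral_renorm_smul hx.2.1, integral_renorm_mul_inner_eq_zero_of_specular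
      (hΩ.norm_outwardNormal hx.1) hx.2.1 hx.2.2.1 hx.2.2.2]
    simp
  rw [lintegral_congr_ae h0, lintegral_zero]

/-- The global entropy inequality controls the Darrozès–Guiraud information. -/
lemma IsRenormalizedSolution.lintegral_dgInformation_le
    (hG : IsRenormalizedSolution Ω b α ε Gin G γG) {t₁ t₂ : ℝ} (ht₁ : 0 ≤ t₁) (ht : t₁ ≤ t₂) :
    ENNReal.ofReal (α / Real.sqrt (2 * Real.pi)) * ∫⁻ t in Ioc t₁ t₂, dgInformation Ω (γG t)
      ≤ relEntropy Ω Gin := by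
  rw [← lintegral_const_mul' _ _ ENNReal.ofReal_ne_top]
  -- The entropy inequality is stated for positive times only, and t₂ may be 0.
  refine le_trans ?_ (hG.entropy (t₂ + 1) (by linarith))
  refine le_trans ?_ le_add_self
  refine (lintegral_mono_set (Ioc_subset_Ioc ht₁ (by linarith : t₂ ≤ t₂ + 1))).trans ?_
  exact lintegral_mono fun s => le_add_self

lemma IsRenormalizedSolution.enorm_boundaryMassFlux_le_dgInformation
    (hΩ : IsSmoothBoundedDomain Ω) (hG : IsRenormalizedSolution Ω b α ε Gin G γG)
    (hα : α ∈ Icc (0 : ℝ) 1) (hα0 : 0 < α) {K : ℝ} (hK0 : 0 ≤ K)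
    (hK : ∀ x ∈ frontier Ω, |χ x| ≤ K) {d : ℝ} (hd : 0 < d) {t₁ t₂ : ℝ} (ht₁ : 0 ≤ t₁)
    (ht : t₁ ≤ t₂) :
    ‖boundaryMassFlux Ω d γG χ t₁ t₂‖ₑ ≤
      ENNReal.ofReal (16 * K / d) * ∫⁻ t in Ioc t₁ t₂, dgInformation Ω (γG t) := by
  have hsub : Ioc t₁ t₂ ⊆ Ioi 0 := fun t h => ht₁.trans_lt h.1
  refine (enorm_boundaryMassFlux_le ht d).trans ?_
  rw [← lintegral_const_mul' _ _ ENNReal.ofReal_ne_top]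
  refine lintegral_mono_ae ?_
  filter_upwards [ae_restrict_of_ae_restrict_of_subset hsub (hG.ae_trace hΩ)] with t ht
  rw [dgInformation, ← lintegral_const_mul' _ _ ENNReal.ofReal_ne_top]
  refine lintegral_mono_ae ?_
  filter_upwards [ht] with x hx
  have h1 := enorm_integral_renorm_mul_inner_le (hΩ.norm_outwardNormal hx.1) hx.2.1 hx.2.2.1
    hα hα0 hx.2.2.2
  have h2 : ‖χ x‖ₑ ≤ ENNReal.ofReal K := by
    rw [← ofReal_norm]
    exact ENNReal.ofReal_le_ofReal (hK x hx.1)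
  have h3 : ‖d⁻¹‖ₑ = ENNReal.ofReal d⁻¹ := Real.enorm_of_nonneg (by positivity)
  rw [inner_integral_renorm_smul hx.2.1, enorm_mul, enorm_mul, h3]
  calc _ ≤ ENNReal.ofReal K * (ENNReal.ofReal d⁻¹ * (16 * _)) := by gcongr
    _ = _ := by
      rw [show 16 * K / d = K * (d⁻¹ * 16) by ring, ENNReal.ofReal_mul hK0,
        ENNReal.ofReal_mul (by positivity), ENNReal.ofReal_ofNat]
      ring

/-- Quantitative form: the renormalized boundary mass flux is of the order of `d`. -/
lemma IsRenormalizedSolution.abs_boundaryMassFlux_le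
    (hΩ : IsSmoothBoundedDomain Ω) (hG : IsRenormalizedSolution Ω b α ε Gin G γG)
    (hα : α ∈ Icc (0 : ℝ) 1) {K : ℝ} (hK0 : 0 ≤ K)
    (hK : ∀ x ∈ frontier Ω, |χ x| ≤ K) {d : ℝ} (hd : 0 < d) {C : ℝ} (hC : 0 ≤ C)
    (hGin : relEntropy Ω Gin ≤ ENNReal.ofReal (C * d ^ 2)) {t₁ t₂ : ℝ} (ht₁ : 0 ≤ t₁)
    (ht : t₁ ≤ t₂) :
    |boundaryMassFlux Ω d γG χ t₁ t₂| ≤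
      16 * K * (α / Real.sqrt (2 * Real.pi))⁻¹ * C * d := by
  -- At α = 0 the inverse on the right is 0 by convention, so the bound demands an exactly zero
  -- flux, which specular reflection gives.
  rcases hα.1.eq_or_lt with rfl | hα0
  · rw [hG.boundaryMassFlux_eq_zero_of_specular hΩ d ht₁ ht]
    simp
  have hc : 0 < α / Real.sqrt (2 * Real.pi) := by positivity
  have h1 := (hG.lintegral_dgInformation_le ht₁ ht).trans hGin
  have h2 : ∫⁻ t in Ioc t₁ t₂, dgInformation Ω (γG t)
      ≤ ENNReal.ofReal ((α / Real.sqrt (2 * Real.pi))⁻¹ * (C * d ^ 2)) := by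
    rw [ENNReal.ofReal_mul (by positivity), ENNReal.ofReal_inv_of_pos hc]
    exact (ENNReal.mul_le_iff_le_inv (ENNReal.ofReal_pos.2 hc).ne' ENNReal.ofReal_ne_top).1 h1
  have h3 := hG.enorm_boundaryMassFlux_le_dgInformation hΩ hα hα0 hK0 hK hd ht₁ ht
  have h4 := h3.trans (mul_le_mul_right h2 _)
  rw [← ENNReal.ofReal_mul (by positivity), ← ofReal_norm,
    ENNReal.ofReal_le_ofReal_iff (by positivity)] at h4
  refine h4.trans_eq ?_
  field_simp

end Flux

end AcousticLimit

/-! ### The limit. -/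

theorem proposition5p1 (D : ℕ) (hD : 1 ≤ D)
    (Ω : Set (AcousticLimit.Space D)) (hΩ : AcousticLimit.IsSmoothBoundedDomain Ω)
    (b : AcousticLimit.Sph D → AcousticLimit.Space D → ℝ)
    (hb : AcousticLimit.IsCollisionKernel b)
    (α : ℝ) (hα : α ∈ Set.Icc (0 : ℝ) 1)
    (δ : ℝ → ℝ) (hδ_pos : ∀ ε : ℝ, 0 < ε → 0 < δ ε)
    (hδ : Tendsto δ (𝓝[>] 0) (𝓝 0))
    (Cin : ℝ)
    (Gin : ℝ → AcousticLimit.Space D × AcousticLimit.Space D → ℝ)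
    (hGin : ∀ ε : ℝ, 0 < ε → AcousticLimit.InEntropyClass Ω (Gin ε))
    (hentropy : ∀ ε : ℝ, 0 < ε →
      AcousticLimit.relEntropy Ω (Gin ε) ≤ ENNReal.ofReal (Cin * δ ε ^ 2))
    (G γG : ℝ → ℝ → AcousticLimit.Space D × AcousticLimit.Space D → ℝ)
    (hG : ∀ ε : ℝ, 0 < ε →
      AcousticLimit.IsRenormalizedSolution Ω b α ε (Gin ε) (G ε) (γG ε))
    (t₁ t₂ : ℝ) (ht₁ : 0 ≤ t₁) (ht₂ : t₁ ≤ t₂)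
    (χ : AcousticLimit.Space D → ℝ) (hχ : ContDiffOn ℝ 1 χ (closure Ω)) :
    (∀ ε : ℝ, 0 < ε →
      Integrable
        (fun p : ℝ × AcousticLimit.Space D × AcousticLimit.Space D =>
          χ p.2.1 * (AcousticLimit.renorm (γG ε p.1 (p.2.2, p.2.1)) / δ ε
            * inner ℝ p.2.2 (AcousticLimit.outwardNormal Ω p.2.1)))
        (AcousticLimit.boundaryTime Ω (Set.Ioc t₁ t₂))) ∧
    Tendsto (fun ε : ℝ => AcousticLimit.boundaryMassFlux Ω (δ ε) (γG ε) χ t₁ t₂)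
      (𝓝[>] 0) (𝓝 0) := by
  refine ⟨fun ε hε => (hG ε hε).integrable_boundary_flux hΩ hχ.continuousOn (δ ε) ht₁, ?_⟩
  obtain ⟨K, hK0, hK⟩ := AcousticLimit.exists_abs_le_on_frontier hΩ hχ.continuousOn
  -- The constant `Cin` may be negative; `max Cin 0` meets the sign condition of the quantitative
  -- bound.
  have hlim : Tendsto (fun ε => 16 * K * (α / Real.sqrt (2 * Real.pi))⁻¹ * max Cin 0 * δ ε)
      (𝓝[>] 0) (𝓝 0) := by
    simpa using hδ.const_mul (16 * K * (α / Real.sqrt (2 * Real.pi))⁻¹ * max Cin 0)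
  refine squeeze_zero_norm' ?_ hlim
  filter_upwards [self_mem_nhdsWithin] with ε hε
  refine (hG ε hε).abs_boundaryMassFlux_le hΩ hα hK0 hK (hδ_pos ε hε) (le_max_right _ _)
    ((hentropy ε hε).trans (ENNReal.ofReal_le_ofReal ?_)) ht₁ ht₂
  gcongr
  exact le_max_left _ _
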